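/- Throughout, scalars are real or complex. A quasi-norm on a vector space $S$ is a map $\|\cdot\|\colon S\to[0,\infty)$ that vanishes only at $0$, is absolutely homogeneous, and satisfies $\|x+y\|\le\kappa(\|x\|+\|y\|)$ for some constant $\kappa$; $S$ is a quasi-Banach space if it is complete for the induced topology. A basis of $S$ is a sequence $(s_j)_{j=1}^\infty$ such that every $x\in S$ has a unique expansion $x=\sum_{j=1}^\infty s_j^*(x)\,s_j$; a basic sequence is a sequence that is a basis of its closed linear span. A sequence $(x_k)$ dominates $(y_k)$ if there is a bounded linear operator from the closed span of $(x_k)$ to the closed span of $(y_k)$ mapping $x_k$ to $y_k$ for all $k$; the two are equivalent if each dominates the other. A basic sequence $(x_k)$ is symmetric if it is equivalent to $(x_{\pi(k)})$ for every permutation $\pi$ of $\mathbb N$. It is subsymmetric if it is unconditional, i.e. $(x_{\pi(k)})$ is a basic sequence for every permutation $\pi$, and it is equivalent to $(x_{\phi(k)})$ for every strictly increasing $\phi\colon\mathbb N\to\mathbb N$. Fix a basis $(s_j)$ of $S$. A block basic sequence is a sequence $(y_k)$ of non-zero vectors such that $i<j$ whenever $s_i^*(y_k)\ne0$ and $s_j^*(y_{k+1})\ne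 0$. It is semi-normalized if $0<\inf_k\|y_k\|$ and $\sup_k\|y_k\|<\infty$, and uniformly null if $\lim_k\sup_j|s_j^*(y_k)|=0$. It is generated by a vector $x\in S$ if there is an unbounded sequence $(n_k)$ of natural numbers and, for each $k$, a strictly increasing $\phi_k\colon\mathbb N\to\mathbb N$ such that $y_k=\sum_{j=1}^{n_k}s_j^*(x)\,s_{\phi_k(j)}$. Theorem. Let $S$ be a quasi-Banach space with a symmetric basis $(s_j)_{j=1}^\infty$ and let $\mathcal B$ be a subsymmetric basic sequence in $S$. Then at least one of the following holds: (a) $\mathcal B$ is equivalent to a subsymmetric block basic sequence generated by a vector $x\in S$; (b) $\mathcal B$ is equivalent to a block basic sequence, and $\mathcal B$ dominates a semi-normalized, uniformly null block basic sequence. Moreover, whenever (a) holds, $\mathcal B$ is symmetric. -/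

import Mathlib

open Filter Topology

noncomputable section

/-- `q` is a quasi-norm on the vector space `S`. -/
structure IsQuasiNorm (𝕜 : Type*) {S : Type*} [RCLike 𝕜] [AddCommGroup S] [Module 𝕜 S]
    (q : S → ℝ) : Prop where
  nonneg : ∀ x, 0 ≤ q x
  eq_zero_iff : ∀ x, q x = 0 ↔ x = 0
  smul : ∀ (c : 𝕜) (x : S), q (c • x) = ‖c‖ * q x
  add_le : ∃ κ : ℝ, ∀ x y, q (x + y) ≤ κ * (q x + q y)

/-- `S`, with its topology (and the translation-invariant uniformity belonging to it), is a
quasi-Banach space under `q`: `q` is a quasi-norm, the sets `{x | q x < ε}` form a basis of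
neighbourhoods of `0`, and `S` is complete. -/
structure IsQuasiBanach (𝕜 : Type*) {S : Type*} [RCLike 𝕜] [AddCommGroup S] [Module 𝕜 S]
    [UniformSpace S] (q : S → ℝ) : Prop where
  quasiNorm : IsQuasiNorm 𝕜 q
  nhds_zero : (𝓝 (0 : S)).HasBasis (fun ε : ℝ => 0 < ε) (fun ε => {x | q x < ε})
  complete : CompleteSpace S

section Sequences

variable (𝕜 : Type*) {S : Type*} [RCLike 𝕜] [AddCommGroup S] [Module 𝕜 S]

/-- The series `∑ j, a j • x j` converges to `v`: its partial sums, in the order of the indices,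
tend to `v`. -/
def SeriesTendsto [TopologicalSpace S] (x : ℕ → S) (a : ℕ → 𝕜) (v : S) : Prop :=
  Tendsto (fun n => ∑ j ∈ Finset.range n, a j • x j) atTop (𝓝 v)

/-- `x` is a (Schauder) basis of the whole space `S`: every vector has a unique expansion. -/
def IsSchauderBasis [TopologicalSpace S] (x : ℕ → S) : Prop :=
  ∀ v : S, ∃! a : ℕ → 𝕜, SeriesTendsto 𝕜 x a v

variable {𝕜} in
/-- The coefficient transform of `v` with respect to a basis. -/
def IsSchauderBasis.coeff [TopologicalSpace S] {s : ℕ → S} (hs : IsSchauderBasis 𝕜 s)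
    (v : S) : ℕ → 𝕜 :=
  (hs v).choose

variable [UniformSpace S] [IsUniformAddGroup S] [ContinuousSMul 𝕜 S]

/-- The closed linear span of a sequence. -/
def closedSpan (x : ℕ → S) : Submodule 𝕜 S :=
  (Submodule.span 𝕜 (Set.range x)).topologicalClosure

theorem mem_closedSpan (x : ℕ → S) (n : ℕ) : x n ∈ closedSpan 𝕜 x :=
  Submodule.le_topologicalClosure _ (Submodule.subset_span ⟨n, rfl⟩)

/-- `x` is a basic sequence: it is a basis of its closed linear span. -/
def IsBasicSeq (x : ℕ → S) : Prop :=
  IsSchauderBasis 𝕜 (fun n => (⟨x n, mem_closedSpan 𝕜 x n⟩ : closedSpan 𝕜 x))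

/-- `x` dominates `y`: there is a bounded linear operator from the closed span of `x` to the closed
span of `y` that maps `x n` to `y n` for all `n`. (Between quasi-normed spaces, a linear operator
is bounded if and only if it is continuous.) -/
def Dominates (x y : ℕ → S) : Prop :=
  ∃ T : closedSpan 𝕜 x →L[𝕜] closedSpan 𝕜 y,
    ∀ n, T ⟨x n, mem_closedSpan 𝕜 x n⟩ = ⟨y n, mem_closedSpan 𝕜 y n⟩

/-- Equivalence of basic sequences: each dominates the other. -/
def SeqEquivalent (x y : ℕ → S) : Prop :=
  Dominates 𝕜 x y ∧ Dominates 𝕜 y x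

/-- A basic sequence equivalent to all its permutations. -/
def IsSymmetricSeq (x : ℕ → S) : Prop :=
  IsBasicSeq 𝕜 x ∧ ∀ π : Equiv.Perm ℕ, SeqEquivalent 𝕜 (x ∘ π) x

/-- An unconditional basic sequence: all its permutations are basic sequences. -/
def IsUnconditionalSeq (x : ℕ → S) : Prop :=
  IsBasicSeq 𝕜 x ∧ ∀ π : Equiv.Perm ℕ, IsBasicSeq 𝕜 (x ∘ π)

/-- An unconditional basic sequence equivalent to all its subsequences. -/
def IsSubsymmetricSeq (x : ℕ → S) : Prop :=
  IsUnconditionalSeq 𝕜 x ∧ ∀ φ : ℕ → ℕ, StrictMono φ → SeqEquivalent 𝕜 (x ∘ φ) x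

end Sequences

/-- Semi-normalized: `0 < inf ‖x k‖` and `sup ‖x k‖ < ∞` for the quasi-norm `q`. -/
def IsSemiNormalized {S : Type*} (q : S → ℝ) (x : ℕ → S) : Prop :=
  ∃ c C : ℝ, 0 < c ∧ ∀ k, c ≤ q (x k) ∧ q (x k) ≤ C

section Blocks

variable {𝕜 S : Type*} [RCLike 𝕜] [AddCommGroup S] [Module 𝕜 S] [TopologicalSpace S]
  {s : ℕ → S} (hs : IsSchauderBasis 𝕜 s)

/-- A block basic sequence of the basis `s`: non-zero vectors, every index in the support of `y k`
being smaller than every index in the support of `y (k + 1)`. -/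
def IsBlockBasic (y : ℕ → S) : Prop :=
  (∀ k, y k ≠ 0) ∧
    ∀ k i j, hs.coeff (y k) i ≠ 0 → hs.coeff (y (k + 1)) j ≠ 0 → i < j

/-- `sup_j |s_j^*(y k)|` tends to `0` as `k → ∞`. -/
def IsUniformlyNull (y : ℕ → S) : Prop :=
  Tendsto (fun k => ⨆ j, ‖hs.coeff (y k) j‖ₑ) atTop (𝓝 0)

/-- `w` is a right-shift of `u = ∑ j, a j • s j`: `w = ∑ j, a j • s (φ j)` for some strictly
increasing `φ`. -/
def IsRightShift (u w : S) : Prop :=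
  ∃ φ : ℕ → ℕ, StrictMono φ ∧ SeriesTendsto 𝕜 (s ∘ φ) (hs.coeff u) w

/-- The block basic sequence `y` is generated by the vector `v`: there is an unbounded sequence `ν`
of natural numbers such that `y k` is a right-shift of the partial sum of `v` of length `ν k`. -/
def IsGeneratedByVector (v : S) (y : ℕ → S) : Prop :=
  IsBlockBasic hs y ∧ ∃ ν : ℕ → ℕ, ¬ BddAbove (Set.range ν) ∧
    ∀ k, IsRightShift hs (∑ j ∈ Finset.range (ν k), hs.coeff v j • s j) (y k)

end Blocks

end

noncomputable section

/-! By Aoki–Rolewicz (`IsQuasiNorm.exists_pNorm`) some power `q ^ p` of the quasi-norm is equivalent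
to a genuine, `p`-homogeneous norm, so one may argue in a complete normed group. There `Dominates`
amounts to an inequality between finite linear combinations (`dominates_iff`).

Baire category over the permutations of `ℕ` makes the constants of symmetry and unconditionality
uniform. The outcome is `IsSymmetricSeq.exists_domination`: up to a constant, a vector is dominated
by another as soon as its coefficients inject into coefficients of larger modulus. Thus only the
decreasing rearrangement of a vector matters.

Differences of a coordinatewise convergent subsequence, followed by a gliding hump, make `B`
equivalent to a block sequence with rows `u k`. Rearrange each row decreasingly and pass to a
coordinatewise limit `a` (`IsBlockModel`); the finite sums of `∑ a j • s j` are bounded. The cases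
are:

* `a` does not tend to `0`: bounded sums with coefficients bounded below force `c₀` behaviour of
both `s` and `B`, so `B` is equivalent to `s`, which is generated by `s 0`. * `a` tends to `0` but
the series diverges: disjoint chunks of it, of norm bounded below, form a uniformly null block
sequence with bounded sums, and `B` dominates any such sequence. * The series converges to `v` and
the rearranged rows come infinitely often arbitrarily close to arbitrarily long truncations of `v`:
a perturbation argument makes `B` equivalent to shifted truncations of `v`. * The series converges
to `v` but the rearranged rows stay away from all long truncations: the parts of the rows beyond the
largest entries stay large in norm while their entries become uniformly small, and `B` dominates
them.

For the last assertion, a sequence generated by `v` has a subsequence equivalent to a sequence of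
disjoint copies of the whole vector `v`. Copies can be permuted freely, so that sequence is
equivalent to its permutations, and hence so is `B`. -/

/-- The norm of `S` is `p`-homogeneous. -/
structure IsPNorm (𝕜 S : Type*) [RCLike 𝕜] [NormedAddCommGroup S] [Module 𝕜 S] (p : ℝ) : Prop where
  pos : 0 < p
  smul : ∀ (c : 𝕜) (x : S), ‖c • x‖ = ‖c‖ ^ p * ‖x‖

/-! ### Homogeneous norms, bounded operators, domination as an inequality -/

section PNorm

variable {𝕜 S F : Type*} [RCLike 𝕜] [NormedAddCommGroup S] [Module 𝕜 S]
  [NormedAddCommGroup F] [Module 𝕜 F] {p : ℝ}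

theorem IsPNorm.submodule (hp : IsPNorm 𝕜 S p) (V : Submodule 𝕜 S) : IsPNorm 𝕜 V p :=
  ⟨hp.pos, fun c x => hp.smul c x⟩

/-- Allows vectors to be rescaled to any prescribed norm although the norm is not 1-homogeneous. -/
theorem IsPNorm.exists_scalar (hp : IsPNorm 𝕜 S p) {r : ℝ} (hr : 0 < r) :
    ∃ c : 𝕜, c ≠ 0 ∧ ‖c‖ ^ p = r := by
  refine ⟨((r ^ (p⁻¹) : ℝ) : 𝕜), ?_, ?_⟩
  · have : r ^ (p⁻¹) ≠ 0 := (Real.rpow_pos_of_pos hr _).ne'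
    exact_mod_cast this
  · rw [RCLike.norm_ofReal, abs_of_pos (Real.rpow_pos_of_pos hr _),
      Real.rpow_inv_rpow hr.le hp.pos.ne']

theorem IsPNorm.norm_inv_rpow {c : 𝕜} {r : ℝ} (h : ‖c‖ ^ p = r) : ‖c⁻¹‖ ^ p = r⁻¹ := by
  rw [norm_inv, Real.inv_rpow (norm_nonneg _), h]

theorem IsPNorm.exists_bound (hp : IsPNorm 𝕜 S p) (hF : IsPNorm 𝕜 F p) (T : S →L[𝕜] F) :
    ∃ C, 0 < C ∧ ∀ x, ‖T x‖ ≤ C * ‖x‖ := by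
  obtain ⟨δ, hδ, h⟩ := Metric.continuousAt_iff.1 (T.continuous.continuousAt (x := 0)) 1 one_pos
  simp only [dist_zero_right, map_zero] at h
  refine ⟨2 / δ, by positivity, fun x => ?_⟩
  rcases eq_or_ne x 0 with rfl | hx
  · simp
  have hx' : 0 < ‖x‖ := norm_pos_iff.2 hx
  obtain ⟨c, hc, hcr⟩ := hp.exists_scalar (r := δ / (2 * ‖x‖)) (by positivity)
  have h1 : ‖c • x‖ < δ := by
    rw [hp.smul, hcr]
    field_simp
    linarith
  have h2 := (h h1).le
  rw [map_smul, hF.smul, hcr] at h2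
  rw [div_mul_eq_mul_div, le_div_iff₀ hδ]
  rw [div_mul_eq_mul_div, div_le_one (by positivity)] at h2
  linarith

theorem IsPNorm.norm_linearCombination_le {ι : Type*} (hp : IsPNorm 𝕜 S p) (x : ι → S) (c : ι →₀ 𝕜) :
    ‖Finsupp.linearCombination 𝕜 x c‖ ≤ ∑ j ∈ c.support, ‖c j‖ ^ p * ‖x j‖ := by
  rw [Finsupp.linearCombination_apply, Finsupp.sum]
  exact (norm_sum_le _ _).trans_eq (Finset.sum_congr rfl fun j _ => hp.smul _ _)

variable [ContinuousSMul 𝕜 S] [ContinuousSMul 𝕜 F]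

theorem linearCombination_mem_closedSpan (x : ℕ → S) (c : ℕ →₀ 𝕜) :
    Finsupp.linearCombination 𝕜 x c ∈ closedSpan 𝕜 x := by
  apply Submodule.le_topologicalClosure
  rw [← Finsupp.range_linearCombination]
  exact ⟨c, rfl⟩

theorem linearCombination_closedSpan (x : ℕ → S) (c : ℕ →₀ 𝕜) :
    Finsupp.linearCombination 𝕜 (fun n => (⟨x n, mem_closedSpan 𝕜 x n⟩ : closedSpan 𝕜 x)) c =
      ⟨Finsupp.linearCombination 𝕜 x c, linearCombination_mem_closedSpan x c⟩ := by
  apply Subtype.ext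
  have := Finsupp.apply_linearCombination 𝕜 (closedSpan 𝕜 x).subtype
    (fun n => (⟨x n, mem_closedSpan 𝕜 x n⟩ : closedSpan 𝕜 x)) c
  simpa using! this

theorem denseRange_linearCombination (x : ℕ → S) :
    DenseRange (Finsupp.linearCombination 𝕜
      (fun n => (⟨x n, mem_closedSpan 𝕜 x n⟩ : closedSpan 𝕜 x))) := by
  intro v
  rw [closure_subtype]
  have hv : (v : S) ∈ closure (Submodule.span 𝕜 (Set.range x) : Set S) := v.2
  refine closure_mono ?_ hv
  intro w hw
  rw [← Finsupp.range_linearCombination] at hw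
  obtain ⟨c, rfl⟩ := hw
  exact ⟨_, ⟨c, rfl⟩, by rw [linearCombination_closedSpan]⟩

/-- An estimate on finite linear combinations extends to a bounded operator. -/
theorem exists_extension [CompleteSpace F] {x : ℕ → S} {y : ℕ → F} {C : ℝ}
    (h : ∀ c : ℕ →₀ 𝕜, ‖Finsupp.linearCombination 𝕜 y c‖ ≤ C * ‖Finsupp.linearCombination 𝕜 x c‖) :
    ∃ T : closedSpan 𝕜 x →L[𝕜] F, (∀ n, T ⟨x n, mem_closedSpan 𝕜 x n⟩ = y n) ∧
      ∀ v, ‖T v‖ ≤ C * ‖v‖ := by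
  set e := Finsupp.linearCombination 𝕜
      (fun n => (⟨x n, mem_closedSpan 𝕜 x n⟩ : closedSpan 𝕜 x)) with he
  have hd : DenseRange e := denseRange_linearCombination x
  have hn : ∀ c, ‖Finsupp.linearCombination 𝕜 y c‖ ≤ C * ‖e c‖ := fun c => by
    rw [he, linearCombination_closedSpan]; exact h c
  let T := ((Finsupp.linearCombination 𝕜 y).compLeftInverse e).extend (LinearMap.range e).subtypeL
  have hT : ∀ c, T (e c) = Finsupp.linearCombination 𝕜 y c := fun c => by
    have := ((Finsupp.linearCombination 𝕜 y).compLeftInverse e).extend_eq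
      (e := (LinearMap.range e).subtypeL) (by simpa using! hd)
      isUniformEmbedding_subtype_val.isUniformInducing ⟨e c, LinearMap.mem_range_self e c⟩
    refine Eq.trans this ?_
    exact LinearMap.compLeftInverse_apply_of_bdd _ _ ⟨C, hn⟩ _ _ rfl
  refine ⟨T, fun n => ?_, fun v => ?_⟩
  · simpa [he] using hT (Finsupp.single n 1)
  · refine hd.induction (P := fun v => ‖T v‖ ≤ C * ‖v‖) ?_ (isClosed_le (by fun_prop) (by fun_prop)) v
    rintro _ ⟨c, rfl⟩
    rw [hT]; exact hn c

variable [CompleteSpace S]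

theorem dominates_iff (hp : IsPNorm 𝕜 S p) {x y : ℕ → S} :
    Dominates 𝕜 x y ↔ ∃ C, 0 < C ∧ ∀ c : ℕ →₀ 𝕜,
      ‖Finsupp.linearCombination 𝕜 y c‖ ≤ C * ‖Finsupp.linearCombination 𝕜 x c‖ := by
  constructor
  · rintro ⟨T, hT⟩
    obtain ⟨C, hC, h⟩ := (hp.submodule _).exists_bound (hp.submodule _) T
    refine ⟨C, hC, fun c => ?_⟩
    have h1 := h ⟨_, linearCombination_mem_closedSpan x c⟩
    rw [← linearCombination_closedSpan, ← ContinuousLinearMap.coe_coe,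
      Finsupp.apply_linearCombination 𝕜 T.toLinearMap, ContinuousLinearMap.coe_coe] at h1
    have h2 : (⇑T ∘ fun n => (⟨x n, mem_closedSpan 𝕜 x n⟩ : closedSpan 𝕜 x)) =
        fun n => (⟨y n, mem_closedSpan 𝕜 y n⟩ : closedSpan 𝕜 y) := funext hT
    rw [h2, linearCombination_closedSpan, linearCombination_closedSpan] at h1
    exact h1
  · rintro ⟨C, -, h⟩
    have : CompleteSpace (closedSpan 𝕜 y) :=
      (Submodule.isClosed_topologicalClosure _).completeSpace_coe
    obtain ⟨T, hT, -⟩ := exists_extension (F := closedSpan 𝕜 y) (x := x)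
      (y := fun n => (⟨y n, mem_closedSpan 𝕜 y n⟩ : closedSpan 𝕜 y)) (C := C) (fun c => by
        rw [linearCombination_closedSpan]; exact h c)
    exact ⟨T, hT⟩

theorem dominates_of_bound (hp : IsPNorm 𝕜 S p) {x y : ℕ → S} {C : ℝ} (h : ∀ c : ℕ →₀ 𝕜,
      ‖Finsupp.linearCombination 𝕜 y c‖ ≤ C * ‖Finsupp.linearCombination 𝕜 x c‖) :
    Dominates 𝕜 x y :=
  (dominates_iff hp).2 ⟨max C 1, by positivity, fun c =>
    (h c).trans (mul_le_mul_of_nonneg_right (le_max_left _ _) (norm_nonneg _))⟩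

end PNorm

/-! ### Formal properties of domination and equivalence -/

section Equivalence

variable {𝕜 S : Type*} [RCLike 𝕜] [NormedAddCommGroup S] [Module 𝕜 S] [ContinuousSMul 𝕜 S]
  {p : ℝ} {x y z : ℕ → S}

theorem Dominates.trans (h : Dominates 𝕜 x y) (h' : Dominates 𝕜 y z) : Dominates 𝕜 x z := by
  obtain ⟨T, hT⟩ := h
  obtain ⟨R, hR⟩ := h'
  exact ⟨R.comp T, fun n => by simp [hT, hR]⟩

theorem SeqEquivalent.trans (h : SeqEquivalent 𝕜 x y) (h' : SeqEquivalent 𝕜 y z) :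
    SeqEquivalent 𝕜 x z :=
  ⟨h.1.trans h'.1, h'.2.trans h.2⟩

theorem SeqEquivalent.symm (h : SeqEquivalent 𝕜 x y) : SeqEquivalent 𝕜 y x :=
  ⟨h.2, h.1⟩

theorem Dominates.refl (x : ℕ → S) : Dominates 𝕜 x x :=
  ⟨ContinuousLinearMap.id _ _, fun _ => rfl⟩

theorem SeqEquivalent.refl (x : ℕ → S) : SeqEquivalent 𝕜 x x :=
  ⟨Dominates.refl x, Dominates.refl x⟩

theorem Dominates.comp_eq_id {T : closedSpan 𝕜 x →L[𝕜] closedSpan 𝕜 y}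
    {R : closedSpan 𝕜 y →L[𝕜] closedSpan 𝕜 x}
    (hT : ∀ n, T ⟨x n, mem_closedSpan 𝕜 x n⟩ = ⟨y n, mem_closedSpan 𝕜 y n⟩)
    (hR : ∀ n, R ⟨y n, mem_closedSpan 𝕜 y n⟩ = ⟨x n, mem_closedSpan 𝕜 x n⟩) (v) :
    R (T v) = v := by
  refine (denseRange_linearCombination x).induction (P := fun v => R (T v) = v) ?_
    (isClosed_eq (by fun_prop) (by fun_prop)) v
  rintro _ ⟨c, rfl⟩
  have : (R.comp T).toLinearMap.comp (Finsupp.linearCombination 𝕜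
      (fun n => (⟨x n, mem_closedSpan 𝕜 x n⟩ : closedSpan 𝕜 x))) = Finsupp.linearCombination 𝕜
      (fun n => (⟨x n, mem_closedSpan 𝕜 x n⟩ : closedSpan 𝕜 x)) := by
    ext n
    simp [hT, hR]
  exact LinearMap.congr_fun this c

theorem SeriesTendsto.map {E F : Type*} [AddCommGroup E] [Module 𝕜 E] [TopologicalSpace E]
    [AddCommGroup F] [Module 𝕜 F] [TopologicalSpace F] {e : ℕ → E} {a : ℕ → 𝕜} {v : E}
    (h : SeriesTendsto 𝕜 e a v) (T : E →L[𝕜] F) : SeriesTendsto 𝕜 (T ∘ e) a (T v) := by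
  have := (T.continuous.tendsto v).comp h
  refine this.congr fun n => ?_
  simp

theorem SeqEquivalent.isBasicSeq (h : SeqEquivalent 𝕜 x y) (hx : IsBasicSeq 𝕜 x) :
    IsBasicSeq 𝕜 y := by
  obtain ⟨⟨T, hT⟩, R, hR⟩ := h
  intro v
  obtain ⟨a, ha, hu⟩ := hx (R v)
  have eT := funext hT
  have eR := funext hR
  refine ⟨a, ?_, fun b hb => hu b ?_⟩
  · have := SeriesTendsto.map ha T
    rw [Dominates.comp_eq_id hR hT] at this
    exact eT ▸ this
  · have := SeriesTendsto.map hb R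
    exact eR ▸ this

theorem IsSymmetricSeq.isUnconditionalSeq (hx : IsSymmetricSeq 𝕜 x) : IsUnconditionalSeq 𝕜 x :=
  ⟨hx.1, fun π => (hx.2 π).symm.isBasicSeq hx.1⟩

variable [CompleteSpace S]

theorem Dominates.comp (hp : IsPNorm 𝕜 S p) (h : Dominates 𝕜 x y) (f : ℕ → ℕ) :
    Dominates 𝕜 (x ∘ f) (y ∘ f) := by
  obtain ⟨C, -, hC⟩ := (dominates_iff hp).1 h
  refine dominates_of_bound hp (C := C) fun c => ?_
  have := hC (c.mapDomain f)
  rwa [Finsupp.linearCombination_mapDomain, Finsupp.linearCombination_mapDomain] at this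

theorem SeqEquivalent.comp (hp : IsPNorm 𝕜 S p) (h : SeqEquivalent 𝕜 x y) (f : ℕ → ℕ) :
    SeqEquivalent 𝕜 (x ∘ f) (y ∘ f) :=
  ⟨h.1.comp hp f, h.2.comp hp f⟩

theorem SeqEquivalent.isSubsymmetricSeq (hp : IsPNorm 𝕜 S p) (h : SeqEquivalent 𝕜 x y)
    (hx : IsSubsymmetricSeq 𝕜 x) : IsSubsymmetricSeq 𝕜 y :=
  ⟨⟨h.isBasicSeq hx.1.1, fun π => (h.comp hp π).isBasicSeq (hx.1.2 π)⟩, fun φ hφ =>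
    ((h.symm.comp hp φ).trans (hx.2 φ hφ)).trans h⟩

end Equivalence

/-! ### Uniform boundedness of the partial sum projections of a basis -/

section Coeff

variable {𝕜 E : Type*} [RCLike 𝕜] [NormedAddCommGroup E] [Module 𝕜 E]
  {e : ℕ → E} (he : IsSchauderBasis 𝕜 e)

namespace IsSchauderBasis

theorem coeff_spec (v : E) : SeriesTendsto 𝕜 e (he.coeff v) v :=
  (he v).choose_spec.1

theorem eq_coeff {a : ℕ → 𝕜} {v : E} (h : SeriesTendsto 𝕜 e a v) : a = he.coeff v :=
  (he v).choose_spec.2 a h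

theorem coeff_smul [ContinuousSMul 𝕜 E] (c : 𝕜) (v : E) : he.coeff (c • v) = c • he.coeff v := by
  refine (he.eq_coeff ?_).symm
  refine ((he.coeff_spec v).const_smul c).congr fun n => ?_
  simp [mul_smul, Finset.smul_sum]

theorem coeff_sub (v w : E) : he.coeff (v - w) = he.coeff v - he.coeff w := by
  refine (he.eq_coeff ?_).symm
  refine ((he.coeff_spec v).sub (he.coeff_spec w)).congr fun n => ?_
  simp [sub_smul, Finset.sum_sub_distrib]

theorem coeff_linearCombination (c : ℕ →₀ 𝕜) :
    he.coeff (Finsupp.linearCombination 𝕜 e c) = c := by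
  refine (he.eq_coeff ?_).symm
  refine tendsto_const_nhds.congr' ?_
  obtain ⟨N, hN⟩ := c.support.exists_nat_subset_range
  filter_upwards [eventually_ge_atTop N] with n hn
  rw [Finsupp.linearCombination_apply, Finsupp.sum_of_support_subset (s := Finset.range n)]
  · exact hN.trans (Finset.range_mono hn)
  · simp

theorem ne_zero {e : ℕ → E} (he : IsSchauderBasis 𝕜 e) (j : ℕ) : e j ≠ 0 := by
  intro h
  have h1 : he.coeff (Finsupp.linearCombination 𝕜 e (Finsupp.single j 1)) = Finsupp.single j 1 :=
    he.coeff_linearCombination _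
  have h2 : he.coeff (Finsupp.linearCombination 𝕜 e 0) = (0 : ℕ →₀ 𝕜) :=
    he.coeff_linearCombination _
  rw [Finsupp.linearCombination_single, h, smul_zero, ← map_zero (Finsupp.linearCombination 𝕜 e),
    h2] at h1
  simpa using congrFun h1 j

/-- The partial sum projections of a basis. -/
def proj (n : ℕ) (v : E) : E := ∑ j ∈ Finset.range n, he.coeff v j • e j

theorem tendsto_proj (v : E) : Tendsto (fun n => he.proj n v) atTop (𝓝 v) :=
  he.coeff_spec v

theorem proj_sub (n : ℕ) (v w : E) : he.proj n (v - w) = he.proj n v - he.proj n w := by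
  simp [proj, he.coeff_sub, sub_smul, Finset.sum_sub_distrib]

theorem proj_smul [ContinuousSMul 𝕜 E] (n : ℕ) (c : 𝕜) (v : E) :
    he.proj n (c • v) = c • he.proj n v := by
  simp [proj, he.coeff_smul, mul_smul, Finset.smul_sum]

theorem proj_succ_sub (n : ℕ) (v : E) :
    he.proj (n + 1) v - he.proj n v = he.coeff v n • e n := by
  simp [proj, Finset.sum_range_succ]

theorem norm_coeff_smul_le {v : E} {C : ℝ} (h : ∀ n, ‖he.proj n v‖ ≤ C) (j : ℕ) :
    ‖he.coeff v j • e j‖ ≤ 2 * C := by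
  rw [← he.proj_succ_sub]
  linarith [norm_sub_le (he.proj (j + 1) v) (he.proj j v), h j, h (j + 1)]

variable [ContinuousSMul 𝕜 E] [CompleteSpace E] {p : ℝ}

/-- Baire category, as in the open mapping theorem. The coefficient functionals are not yet known to
be continuous, so the sets `A m` need not be closed; their closures cover the space, and only
approximation results. Subtracting approximants of `v₀` and `v₀ + w` moves the ball to the origin
and doubles the bound. -/
theorem exists_approx (hp : IsPNorm 𝕜 E p) : ∃ C, 0 < C ∧ ∀ (w : E) (ε : ℝ), 0 < ε →
    ∃ u, ‖w - u‖ < ε ∧ ∀ n, ‖he.proj n u‖ ≤ C * ‖w‖ := by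
  let A : ℕ → Set E := fun m => {v | ∀ n, ‖he.proj n v‖ ≤ m}
  have hA : ⋃ m, closure (A m) = Set.univ := by
    refine Set.eq_univ_of_forall fun v => ?_
    obtain ⟨M, hM⟩ := (he.tendsto_proj v).norm.bddAbove_range
    obtain ⟨m, hm⟩ := exists_nat_ge M
    exact Set.mem_iUnion.2 ⟨m, subset_closure fun n => (hM ⟨n, rfl⟩).trans hm⟩
  obtain ⟨m, v₀, hv₀⟩ := nonempty_interior_of_iUnion_of_closed (fun _ => isClosed_closure) hA
  obtain ⟨r, hr, hball⟩ := Metric.mem_nhds_iff.1 (mem_interior_iff_mem_nhds.1 hv₀)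
  have key : ∀ w : E, ‖w‖ < r → ∀ ε : ℝ, 0 < ε → ∃ u, ‖w - u‖ < ε ∧ ∀ n, ‖he.proj n u‖ ≤ 2 * m := by
    intro w hw ε hε
    obtain ⟨a, ha, hav⟩ := Metric.mem_closure_iff.1 (hball (show v₀ + w ∈ _ by simpa using hw))
      (ε / 2) (half_pos hε)
    obtain ⟨b, hb, hbv⟩ := Metric.mem_closure_iff.1 (hball (Metric.mem_ball_self hr))
      (ε / 2) (half_pos hε)
    rw [dist_eq_norm] at hav hbv
    refine ⟨a - b, ?_, fun n => ?_⟩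
    · have : w - (a - b) = (v₀ + w - a) - (v₀ - b) := by abel
      rw [this]
      linarith [norm_sub_le (v₀ + w - a) (v₀ - b)]
    · rw [he.proj_sub]
      linarith [norm_sub_le (he.proj n a) (he.proj n b), ha n, hb n]
  refine ⟨4 * m / r + 1, by positivity, fun w ε hε => ?_⟩
  rcases eq_or_ne w 0 with rfl | hw
  · refine ⟨0, by simpa using hε, fun n => ?_⟩
    have := he.proj_sub n 0 0
    rw [sub_self, sub_self] at this
    simp [this]
  have hw' : 0 < ‖w‖ := norm_pos_iff.2 hw
  obtain ⟨c, hc, hcr⟩ := hp.exists_scalar (r := r / (2 * ‖w‖)) (by positivity)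
  obtain ⟨u, hu, hun⟩ := key (c • w) (by rw [hp.smul, hcr]; field_simp; linarith)
    (r / (2 * ‖w‖) * ε) (by positivity)
  have hci := IsPNorm.norm_inv_rpow hcr
  refine ⟨c⁻¹ • u, ?_, fun n => ?_⟩
  · have : w - c⁻¹ • u = c⁻¹ • (c • w - u) := by rw [smul_sub, inv_smul_smul₀ hc]
    rw [this, hp.smul, hci, inv_mul_lt_iff₀ (by positivity)]
    exact hu
  · rw [he.proj_smul, hp.smul, hci, inv_mul_le_iff₀ (by positivity)]
    refine (hun n).trans ?_
    have : r / (2 * ‖w‖) * ((4 * m / r + 1) * ‖w‖) = 2 * m + r / 2 := by field_simp; ring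
    rw [this]
    linarith

/-- Successive approximation: `w i` is the remainder after `i` corrections. The tolerances are
proportional to `‖v‖`, hence the restriction to `v ≠ 0`. -/
theorem exists_series (hp : IsPNorm 𝕜 E p) : ∃ C, 0 < C ∧ ∀ v : E, v ≠ 0 →
    ∃ u : ℕ → E, Tendsto (fun n => ∑ i ∈ Finset.range n, u i) atTop (𝓝 v) ∧
      ∀ i n, ‖he.proj n (u i)‖ ≤ C * ‖v‖ * (1 / 2) ^ i := by
  obtain ⟨C, hC, h⟩ := he.exists_approx hp
  refine ⟨C, hC, fun v hv => ?_⟩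
  have hv' : 0 < ‖v‖ := norm_pos_iff.2 hv
  choose! f hf hfn using h
  let w : ℕ → E := fun i => Nat.rec v (fun i z => z - f z (‖v‖ * (1 / 2) ^ (i + 1))) i
  have hw : ∀ i, ‖w i‖ ≤ ‖v‖ * (1 / 2) ^ i := by
    rintro (_ | i)
    · simp [w]
    · exact (hf (w i) _ (by positivity)).le
  refine ⟨fun i => w i - w (i + 1), ?_, fun i n => ?_⟩
  · simp_rw [Finset.sum_range_sub']
    have : Tendsto w atTop (𝓝 0) := by
      refine squeeze_zero_norm hw ?_
      simpa using (tendsto_pow_atTop_nhds_zero_of_lt_one (r := (1 / 2 : ℝ)) (by norm_num)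
        (by norm_num)).const_mul ‖v‖
    simpa [w] using tendsto_const_nhds (x := w 0).sub this
  · have : w i - w (i + 1) = f (w i) (‖v‖ * (1 / 2) ^ (i + 1)) := sub_sub_cancel _ _
    beta_reduce
    rw [this, mul_assoc]
    exact (hfn _ _ (by positivity) n).trans (mul_le_mul_of_nonneg_left (hw i) hC.le)

/-- Write `v` as a series of vectors `u i` whose projections are geometrically small, uniformly in
`n`. Dominated convergence interchanges the sum over `i` with the limit of the projections, and
uniqueness of expansions identifies the summed coefficients with those of `v`. -/
theorem exists_proj_bound (hp : IsPNorm 𝕜 E p) :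
    ∃ K, 0 < K ∧ ∀ (v : E) (n : ℕ), ‖he.proj n v‖ ≤ K * ‖v‖ := by
  obtain ⟨C, hC, h⟩ := he.exists_series hp
  refine ⟨2 * C, by positivity, fun v n => ?_⟩
  rcases eq_or_ne v 0 with rfl | hv
  · have := he.proj_sub n 0 0
    rw [sub_self, sub_self] at this
    simp [this]
  obtain ⟨u, hu, hun⟩ := h v hv
  have hgeo : HasSum (fun i : ℕ => C * ‖v‖ * (1 / 2) ^ i) (C * ‖v‖ * 2) :=
    hasSum_geometric_two.mul_left _
  have hub : ∀ i, ‖u i‖ ≤ C * ‖v‖ * (1 / 2) ^ i := fun i =>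
    le_of_tendsto (he.tendsto_proj (u i)).norm (Eventually.of_forall fun n => hun i n)
  have hus : HasSum u v := by
    have hs : Summable u := Summable.of_norm_bounded hgeo.summable hub
    exact (tendsto_nhds_unique hs.hasSum.tendsto_sum_nat hu) ▸ hs.hasSum
  have hcs : ∀ j, Summable fun i => he.coeff (u i) j := by
    intro j
    have hej : 0 < ‖e j‖ := norm_pos_iff.2 (he.ne_zero j)
    set q : ℝ := p⁻¹ with hq
    have hqp : 0 < q := inv_pos.2 hp.pos
    -- Coefficients scale like the `1 / p`-th power of norms, so the geometric ratio becomes `(1 /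
    -- 2) ^ p⁻¹`, still less than `1`.
    refine Summable.of_norm_bounded (g := fun i : ℕ =>
      (2 * (C * ‖v‖) / ‖e j‖) ^ q * ((1 / 2 : ℝ) ^ q) ^ i) ?_ fun i => ?_
    · refine (summable_geometric_of_lt_one (by positivity) ?_).mul_left _
      exact Real.rpow_lt_one (by norm_num) (by norm_num) hqp
    · have h1 := he.norm_coeff_smul_le (hun i) j
      rw [hp.smul, ← le_div_iff₀ hej] at h1
      have h2 := Real.rpow_le_rpow (by positivity) h1 hqp.le
      rw [Real.rpow_rpow_inv (norm_nonneg _) hp.pos.ne'] at h2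
      refine h2.trans_eq ?_
      rw [← Real.rpow_natCast ((1 / 2 : ℝ) ^ q), ← Real.rpow_mul (by norm_num), mul_comm q,
        Real.rpow_mul (by norm_num), Real.rpow_natCast, ← Real.mul_rpow (by positivity)
        (by positivity)]
      congr 1
      ring
  set a : ℕ → 𝕜 := fun j => ∑' i, he.coeff (u i) j with ha
  have hproj : ∀ n, HasSum (fun i => he.proj n (u i)) (∑ j ∈ Finset.range n, a j • e j) :=
    fun n => hasSum_sum fun j _ => (hcs j).hasSum.smul_const (e j)
  have hav : a = he.coeff v := by
    refine he.eq_coeff ?_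
    have := tendsto_tsum_of_dominated_convergence (𝓕 := atTop) (f := fun n i => he.proj n (u i))
      hgeo.summable (fun i => he.tendsto_proj (u i)) (Eventually.of_forall fun n i => hun i n)
    rw [hus.tsum_eq] at this
    exact this.congr fun n => (hproj n).tsum_eq
  have : he.proj n v = ∑' i, he.proj n (u i) := by
    rw [(hproj n).tsum_eq, hav]
    rfl
  rw [this]
  refine (tsum_of_norm_bounded hgeo fun i => hun i n).trans_eq ?_
  ring

end IsSchauderBasis

end Coeff

/-! ### Basis constants of basic sequences -/

section Basic

variable {𝕜 S : Type*} [RCLike 𝕜] [NormedAddCommGroup S] [Module 𝕜 S]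

theorem linearCombination_filter_lt (x : ℕ → S) (c : ℕ →₀ 𝕜) (n : ℕ) :
    Finsupp.linearCombination 𝕜 x (c.filter (· < n)) = ∑ j ∈ Finset.range n, c j • x j := by
  rw [Finsupp.linearCombination_apply, Finsupp.sum_of_support_subset (s := Finset.range n)]
  · exact Finset.sum_congr rfl fun j hj => by rw [Finsupp.filter_apply_pos _ _ (by simpa using hj)]
  · intro j hj
    rw [Finsupp.support_filter, Finset.mem_filter] at hj
    simpa using hj.2
  · simp

variable [ContinuousSMul 𝕜 S] {p : ℝ} {x : ℕ → S}

theorem IsBasicSeq.ne_zero (hx : IsBasicSeq 𝕜 x) (j : ℕ) : x j ≠ 0 := fun h =>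
  IsSchauderBasis.ne_zero hx j (Subtype.ext h)

variable [CompleteSpace S]

theorem IsBasicSeq.exists_bound (hp : IsPNorm 𝕜 S p) (hx : IsBasicSeq 𝕜 x) :
    ∃ K, 0 < K ∧ (∀ (c : ℕ →₀ 𝕜) (n : ℕ), ‖Finsupp.linearCombination 𝕜 x (c.filter (· < n))‖ ≤
      K * ‖Finsupp.linearCombination 𝕜 x c‖) ∧ ∀ (c : ℕ →₀ 𝕜) (j : ℕ),
      ‖c j‖ ^ p * ‖x j‖ ≤ K * ‖Finsupp.linearCombination 𝕜 x c‖ := by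
  have : CompleteSpace (closedSpan 𝕜 x) :=
    (Submodule.isClosed_topologicalClosure _).completeSpace_coe
  have hx' : IsSchauderBasis 𝕜 (fun n => (⟨x n, mem_closedSpan 𝕜 x n⟩ : closedSpan 𝕜 x)) := hx
  obtain ⟨K, hK, h⟩ := hx'.exists_proj_bound (hp.submodule _)
  have key : ∀ (c : ℕ →₀ 𝕜) (n : ℕ), ‖∑ j ∈ Finset.range n, c j • x j‖ ≤
      K * ‖Finsupp.linearCombination 𝕜 x c‖ := by
    intro c n
    have h1 := h (Finsupp.linearCombination 𝕜
      (fun n => (⟨x n, mem_closedSpan 𝕜 x n⟩ : closedSpan 𝕜 x)) c) n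
    rw [IsSchauderBasis.proj, hx'.coeff_linearCombination, linearCombination_closedSpan] at h1
    simpa using! h1
  -- The factor `2` serves the second claim, where a single term is the difference of two partial
  -- sums.
  refine ⟨2 * K, by positivity, fun c n => ?_, fun c j => ?_⟩
  · rw [linearCombination_filter_lt]
    have := mul_nonneg hK.le (norm_nonneg (Finsupp.linearCombination 𝕜 x c))
    linarith [key c n]
  · have h1 : c j • x j = ∑ i ∈ Finset.range (j + 1), c i • x i - ∑ i ∈ Finset.range j, c i • x i := by
      simp [Finset.sum_range_succ]
    rw [← hp.smul, h1]
    linarith [norm_sub_le (∑ i ∈ Finset.range (j + 1), c i • x i) (∑ i ∈ Finset.range j, c i • x i),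
      key c j, key c (j + 1)]

end Basic

/-! ### Extending finite injections, and Baire category for permutations -/

section Permutations

theorem exists_perm_extending (A : Finset ℕ) (f : ℕ → ℕ) (hf : Set.InjOn f A) :
    ∃ π : Equiv.Perm ℕ, ∀ i ∈ A, π i = f i := by
  obtain ⟨N, hN⟩ := (A ∪ A.image f).exists_nat_subset_range
  have h1 : (Finset.univ.filter fun i : Fin N => (i : ℕ) ∈ A).image (fun i : Fin N => f i) ⊆
      Finset.range N := by
    intro j hj
    obtain ⟨i, hi, rfl⟩ := Finset.mem_image.1 hj
    exact hN (Finset.mem_union_right _ (Finset.mem_image_of_mem f (Finset.mem_filter.1 hi).2))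
  obtain ⟨g, hg⟩ := Finset.exists_equiv_extend_of_card_eq (α := Fin N) (t := Finset.range N)
    (by simp) h1 (fun i hi j hj h => by
      simp only [Finset.coe_filter, Finset.mem_univ, true_and, Set.mem_ofPred_eq] at hi hj
      exact Fin.ext (hf hi hj h))
  let e : Equiv.Perm {i // i < N} := Fin.equivSubtype.symm.trans
    (g.trans (Equiv.subtypeEquivRight fun i => Finset.mem_range))
  refine ⟨e.extendDomain (Equiv.refl {i // i < N}), fun i hi => ?_⟩
  have hiN : i < N := Finset.mem_range.1 (hN (Finset.mem_union_left _ hi))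
  have := Equiv.Perm.extendDomain_apply_subtype e (Equiv.refl {i // i < N}) hiN
  rw [this]
  exact hg ⟨i, hiN⟩ (by simpa using hi)

/-- The Baire category theorem for the permutations of `ℕ`. -/
theorem exists_perm_agree {F : ℕ → (ℕ → ℕ) → Prop} (hF : ∀ m, IsClosed {f | F m f})
    (h : ∀ π : Equiv.Perm ℕ, ∃ m, F m π) :
    ∃ (m n : ℕ) (π₀ : Equiv.Perm ℕ), ∀ π : Equiv.Perm ℕ, (∀ i < n, π i = π₀ i) → F m π := by
  -- The permutations are not closed in `ℕ → ℕ`, but the pairs of a permutation and its inverse form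
  -- a closed, hence Polish, subset of the product.
  let X : Set ((ℕ → ℕ) × (ℕ → ℕ)) := {fg | ∀ i j, fg.1 i = j ↔ fg.2 j = i}
  have hX : IsClosed X := by
    simp only [X, Set.ofPred_forall]
    refine isClosed_iInter fun i => isClosed_iInter fun j => ?_
    have hc : Continuous fun fg : (ℕ → ℕ) × (ℕ → ℕ) => (fg.1 i, fg.2 j) := by fun_prop
    exact (isClosed_discrete {ab : ℕ × ℕ | ab.1 = j ↔ ab.2 = i}).preimage hc
  have : PolishSpace X := hX.polishSpace
  let toPerm : X → Equiv.Perm ℕ := fun fg =>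
    ⟨fg.1.1, fg.1.2, fun i => (fg.2 i _).1 rfl, fun j => (fg.2 _ j).2 rfl⟩
  have : Nonempty X := ⟨⟨(id, id), fun i j => eq_comm⟩⟩
  obtain ⟨m, fg₀, hint⟩ := nonempty_interior_of_iUnion_of_closed (X := X)
    (f := fun m => {fg : X | F m fg.1.1})
    (fun m => (hF m).preimage (by fun_prop : Continuous fun fg : X => fg.1.1))
    (Set.eq_univ_of_forall fun fg => Set.mem_iUnion.2 (h (toPerm fg)))
  rw [mem_interior_iff_mem_nhds, mem_nhds_subtype] at hint
  obtain ⟨U, hU, hUF⟩ := hint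
  obtain ⟨V, hV, W, hW, hVW⟩ := mem_nhds_prod_iff.1 hU
  rw [nhds_pi, Filter.mem_pi] at hV hW
  obtain ⟨I, hI, t, ht, htV⟩ := hV
  obtain ⟨J, hJ, r, hr, hrW⟩ := hW
  -- Prescribing the inverse at `j` is the same as prescribing the permutation at the preimage of
  -- `j`, so agreement on one initial segment suffices.
  obtain ⟨n, hn⟩ := (hI.toFinset ∪ hJ.toFinset.image fg₀.1.2).exists_nat_subset_range
  refine ⟨m, n, toPerm fg₀, fun π hπ => ?_⟩
  have hmem : ((π : ℕ → ℕ), (π.symm : ℕ → ℕ)) ∈ X := fun i j =>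
    ⟨fun h => by rw [← h]; exact π.symm_apply_apply i, fun h => by
      rw [← h]; exact π.apply_symm_apply j⟩
  refine hUF (show (⟨_, hmem⟩ : X).1 ∈ U from hVW ⟨htV fun i hi => ?_, hrW fun j hj => ?_⟩)
  · have : π i = fg₀.1.1 i := hπ i (Finset.mem_range.1 (hn (Finset.mem_union_left _ (by simpa))))
    change π i ∈ t i
    rw [this]
    exact mem_of_mem_nhds (ht i)
  · have h1 : π (fg₀.1.2 j) = toPerm fg₀ (fg₀.1.2 j) := hπ _ (Finset.mem_range.1 (hn
      (Finset.mem_union_right _ (Finset.mem_image_of_mem _ (by simpa)))))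
    have h2 : toPerm fg₀ (fg₀.1.2 j) = j := (toPerm fg₀).apply_symm_apply j
    have h3 : π.symm j = fg₀.1.2 j := by rw [Equiv.symm_apply_eq, h1, h2]
    change π.symm j ∈ r j
    rw [h3]
    exact mem_of_mem_nhds (hr j)

end Permutations

/-! ### Uniform constants for symmetric sequences -/

section Uniform

variable {𝕜 S : Type*} [RCLike 𝕜] [NormedAddCommGroup S] [Module 𝕜 S] {p : ℝ} {x : ℕ → S}

theorem IsPNorm.norm_linearCombination_le_card (hp : IsPNorm 𝕜 S p) (x : ℕ → S) {c : ℕ →₀ 𝕜}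
    {Z : Finset ℕ} (hZ : c.support ⊆ Z) {M : ℝ} (hM : ∀ j, ‖c j‖ ^ p * ‖x j‖ ≤ M) :
    ‖Finsupp.linearCombination 𝕜 x c‖ ≤ Z.card * M := by
  refine (hp.norm_linearCombination_le x c).trans ?_
  refine (Finset.sum_le_card_nsmul _ _ M fun j _ => hM j).trans ?_
  rw [nsmul_eq_mul]
  refine mul_le_mul_of_nonneg_right (by exact_mod_cast Finset.card_le_card hZ) ?_
  exact le_trans (by positivity) (hM 0)

theorem IsPNorm.rpow_zero_norm (hp : IsPNorm 𝕜 S p) : ‖(0 : 𝕜)‖ ^ p = 0 := by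
  rw [norm_zero, Real.zero_rpow hp.pos.ne']

theorem IsPNorm.filter_le (hp : IsPNorm 𝕜 S p) {c : ℕ →₀ 𝕜} (P : ℕ → Prop) [DecidablePred P]
    {M : ℝ} (hM : ∀ j, ‖c j‖ ^ p * ‖x j‖ ≤ M) (j : ℕ) : ‖c.filter P j‖ ^ p * ‖x j‖ ≤ M := by
  rw [Finsupp.filter_apply]
  split_ifs
  · exact hM j
  · rw [hp.rpow_zero_norm, zero_mul]
    exact le_trans (by positivity) (hM 0)

theorem linearCombination_filter_add (x : ℕ → S) (c : ℕ →₀ 𝕜) (P : ℕ → Prop) [DecidablePred P] :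
    Finsupp.linearCombination 𝕜 x c = Finsupp.linearCombination 𝕜 x (c.filter P) +
      Finsupp.linearCombination 𝕜 x (c.filter fun j => ¬ P j) := by
  rw [← map_add, Finsupp.filter_add_filter_not]

theorem continuous_linearCombination_comp [ContinuousSMul 𝕜 S] (x : ℕ → S) (c : ℕ →₀ 𝕜) :
    Continuous fun f : ℕ → ℕ => Finsupp.linearCombination 𝕜 (x ∘ f) c := by
  simp only [Finsupp.linearCombination_apply, Finsupp.sum]
  exact continuous_finsetSum _ fun j _ =>
    ((continuous_of_discreteTopology (f := x)).comp (continuous_apply j)).const_smul _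

variable [ContinuousSMul 𝕜 S] [CompleteSpace S]

/-- Baire gives a uniform constant `m` for all permutations that agree with `π₀` below `n`. An
injection that avoids these indices and their images extends to such a permutation; the finitely
many exceptional terms are controlled by the coefficient functionals. -/
theorem IsSymmetricSeq.exists_uniform_bound (hp : IsPNorm 𝕜 S p) (hx : IsSymmetricSeq 𝕜 x) :
    (∃ l h, 0 < l ∧ ∀ k, l ≤ ‖x k‖ ∧ ‖x k‖ ≤ h) ∧
    ∃ C, 0 < C ∧ ∀ (c : ℕ →₀ 𝕜) (f : ℕ → ℕ), Set.InjOn f c.support →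
      ‖Finsupp.linearCombination 𝕜 (x ∘ f) c‖ ≤ C * ‖Finsupp.linearCombination 𝕜 x c‖ := by
  classical
  obtain ⟨K, hK, -, hcoef⟩ := hx.1.exists_bound hp
  obtain ⟨m, n, π₀, hπ⟩ := exists_perm_agree
    (F := fun m f => ∀ c : ℕ →₀ 𝕜, ‖Finsupp.linearCombination 𝕜 (x ∘ f) c‖ ≤
      m * ‖Finsupp.linearCombination 𝕜 x c‖) (fun m => by
      simp only [Set.ofPred_forall]
      exact isClosed_iInter fun c =>
        isClosed_le (continuous_linearCombination_comp x c).norm continuous_const) (fun π => by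
      obtain ⟨C, -, h⟩ := (dominates_iff hp).1 (hx.2 π).2
      obtain ⟨m, hm⟩ := exists_nat_ge C
      exact ⟨m, fun c => (h c).trans (mul_le_mul_of_nonneg_right hm (norm_nonneg _))⟩)
  set R := (Finset.range n).image π₀ with hR
  have good : ∀ (c : ℕ →₀ 𝕜) (f : ℕ → ℕ), Set.InjOn f c.support → (∀ i ∈ c.support, n ≤ i) →
      (∀ i ∈ c.support, f i ∉ R) → ‖Finsupp.linearCombination 𝕜 (x ∘ f) c‖ ≤
        m * ‖Finsupp.linearCombination 𝕜 x c‖ := by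
    intro c f hf hc hfR
    obtain ⟨π, hπf⟩ := exists_perm_extending (Finset.range n ∪ c.support)
      (fun i => if i < n then π₀ i else f i) (by
        have hne : ∀ i ∈ c.support, ∀ j < n, π₀ j ≠ f i := fun i hi j hj h => by
          refine hfR i hi ?_
          rw [hR, ← h]
          exact Finset.mem_image_of_mem _ (Finset.mem_range.2 hj)
        intro i hi j hj hij
        simp only [Finset.coe_union, Set.mem_union, Finset.mem_coe, Finset.mem_range] at hi hj
        by_cases hin : i < n <;> by_cases hjn : j < n
        · simp only [hin, hjn, if_true] at hij
          exact π₀.injective hij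
        · simp only [hin, hjn, if_true, if_false] at hij
          exact absurd hij (hne j (hj.resolve_left hjn) i hin)
        · simp only [hin, hjn, if_true, if_false] at hij
          exact absurd hij.symm (hne i (hi.resolve_left hin) j hjn)
        · simp only [hin, hjn, if_false] at hij
          exact hf (hi.resolve_left hin) (hj.resolve_left hjn) hij)
    have h1 := hπ π (fun i hi => by
      rw [hπf i (Finset.mem_union_left _ (Finset.mem_range.2 hi)), if_pos hi]) c
    have h2 : Finsupp.linearCombination 𝕜 (x ∘ π) c = Finsupp.linearCombination 𝕜 (x ∘ f) c := by
      simp only [Finsupp.linearCombination_apply]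
      refine Finsupp.sum_congr fun i hi => ?_
      simp only [Function.comp_apply]
      rw [hπf i (Finset.mem_union_right _ hi), if_neg (hc i hi).not_gt]
    rwa [h2] at h1
  have hsn : ∃ l h, 0 < l ∧ ∀ k, l ≤ ‖x k‖ ∧ ‖x k‖ ≤ h := by
    have hpos : ∀ k, 0 < ‖x k‖ := fun k => norm_pos_iff.2 (hx.1.ne_zero k)
    -- Comparing single basis vectors: fixing `j` bounds the norms above, fixing `k` bounds them
    -- below, outside finite sets.
    have hsing : ∀ j k, n ≤ j → k ∉ R → ‖x k‖ ≤ m * ‖x j‖ := fun j k hj hk => by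
      have := good (Finsupp.single j 1) (fun _ => k)
        (fun a ha b hb _ => by
          rw [Finset.mem_coe, Finsupp.mem_support_single] at ha hb
          exact ha.1.trans hb.1.symm)
        (fun i hi => by rw [Finsupp.mem_support_single] at hi; exact hi.1 ▸ hj) (fun _ _ => hk)
      simpa using this
    obtain ⟨k₀, hk₀⟩ := Infinite.exists_notMem_finset R
    have hm : (0 : ℝ) < m := by
      by_contra hm
      have := hsing n k₀ le_rfl hk₀
      nlinarith [hpos k₀, hpos n]
    have hinv : ∀ k, ‖x k‖⁻¹ ≤ ∑ i ∈ Finset.range n, ‖x i‖⁻¹ + m / ‖x k₀‖ := fun k => by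
      rcases lt_or_ge k n with h | h
      · have := Finset.single_le_sum (f := fun i => ‖x i‖⁻¹) (fun i _ => by positivity)
          (Finset.mem_range.2 h)
        have h2 : 0 ≤ m / ‖x k₀‖ := by positivity
        linarith
      · have h1 : ‖x k‖⁻¹ ≤ m / ‖x k₀‖ := by
          rw [le_div_iff₀ (hpos _), inv_mul_le_iff₀ (hpos _), mul_comm]
          exact hsing k k₀ h hk₀
        have h2 : 0 ≤ ∑ i ∈ Finset.range n, ‖x i‖⁻¹ := Finset.sum_nonneg fun i _ => by positivity
        linarith
    have hM : 0 < ∑ i ∈ Finset.range n, ‖x i‖⁻¹ + m / ‖x k₀‖ :=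
      add_pos_of_nonneg_of_pos (Finset.sum_nonneg fun i _ => by positivity)
        (div_pos hm (hpos _))
    refine ⟨(∑ i ∈ Finset.range n, ‖x i‖⁻¹ + m / ‖x k₀‖)⁻¹, ∑ i ∈ R, ‖x i‖ + m * ‖x n‖,
      inv_pos.2 hM, fun k => ⟨?_, ?_⟩⟩
    · exact inv_le_of_inv_le₀ (hpos k) (hinv k)
    · by_cases h : k ∈ R
      · have := Finset.single_le_sum (f := fun i => ‖x i‖) (fun i _ => by positivity) h
        have h2 : 0 ≤ m * ‖x n‖ := by positivity
        linarith
      · have h2 : 0 ≤ ∑ i ∈ R, ‖x i‖ := Finset.sum_nonneg fun i _ => by positivity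
        linarith [hsing n k le_rfl h]
  refine ⟨hsn, ?_⟩
  obtain ⟨l, h, hl, hlh⟩ := hsn
  have hh : 0 < h := hl.trans_le ((hlh 0).1.trans (hlh 0).2)
  refine ⟨m * (1 + 2 * n * K) + 2 * n * (K / l * h) + 1, by positivity, fun c f hf => ?_⟩
  set V := ‖Finsupp.linearCombination 𝕜 x c‖ with hV
  -- The indices outside the scope of `good`: at most `n` of each kind, the second because `f` is
  -- injective on the support.
  let Z : Finset ℕ := Finset.range n ∪ c.support.filter fun i => f i ∈ R
  have hZ : (Z.card : ℝ) ≤ 2 * n := by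
    have h1 : (c.support.filter fun i => f i ∈ R).card ≤ R.card :=
      Finset.card_le_card_of_injOn f (fun i hi => (Finset.mem_filter.1 hi).2)
        (hf.mono fun i hi => (Finset.mem_filter.1 hi).1)
    have h2 : R.card ≤ n := Finset.card_image_le.trans_eq (Finset.card_range n)
    have h3 : Z.card ≤ n + n := (Finset.card_union_le _ _).trans
      (add_le_add (Finset.card_range n).le (h1.trans h2))
    have : (Z.card : ℝ) ≤ ((n + n : ℕ) : ℝ) := by exact_mod_cast h3
    push_cast at this
    linarith
  have hsupp : (c.filter (· ∈ Z)).support ⊆ Z := fun i hi => by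
    rw [Finsupp.support_filter] at hi
    exact (Finset.mem_filter.1 hi).2
  have hMf : ∀ j, ‖c j‖ ^ p * ‖(x ∘ f) j‖ ≤ K / l * h * V := fun j => by
    have h1 : ‖c j‖ ^ p * l ≤ K * V :=
      (mul_le_mul_of_nonneg_left (hlh j).1 (by positivity)).trans (hcoef c j)
    calc ‖c j‖ ^ p * ‖(x ∘ f) j‖ ≤ ‖c j‖ ^ p * h :=
          mul_le_mul_of_nonneg_left (hlh _).2 (by positivity)
      _ = (‖c j‖ ^ p * l) * (h / l) := by field_simp
      _ ≤ K * V * (h / l) := mul_le_mul_of_nonneg_right h1 (by positivity)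
      _ = K / l * h * V := by ring
  have hV0 : 0 ≤ V := norm_nonneg _
  have e1 : ‖Finsupp.linearCombination 𝕜 (x ∘ f) (c.filter (· ∈ Z))‖ ≤
      2 * n * (K / l * h * V) :=
    (hp.norm_linearCombination_le_card (x ∘ f) hsupp (hp.filter_le _ hMf)).trans
      (mul_le_mul_of_nonneg_right hZ (by positivity))
  have e2 : ‖Finsupp.linearCombination 𝕜 x (c.filter (· ∈ Z))‖ ≤ 2 * n * (K * V) :=
    (hp.norm_linearCombination_le_card x hsupp (hp.filter_le _ (hcoef c))).trans
      (mul_le_mul_of_nonneg_right hZ (by positivity))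
  have hs' : ∀ i ∈ (c.filter fun j => ¬ j ∈ Z).support, i ∈ c.support ∧ i ∉ Z := fun i hi => by
    rw [Finsupp.support_filter] at hi
    exact Finset.mem_filter.1 hi
  have e3 : ‖Finsupp.linearCombination 𝕜 (x ∘ f) (c.filter fun j => ¬ j ∈ Z)‖ ≤
      m * ‖Finsupp.linearCombination 𝕜 x (c.filter fun j => ¬ j ∈ Z)‖ := by
    refine good _ f (hf.mono fun i hi => (hs' i hi).1) (fun i hi => ?_) fun i hi hfi => ?_
    · by_contra hlt
      exact (hs' i hi).2 (Finset.mem_union_left _ (Finset.mem_range.2 (not_le.1 hlt)))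
    · exact (hs' i hi).2 (Finset.mem_union_right _ (Finset.mem_filter.2 ⟨(hs' i hi).1, hfi⟩))
  have e4 : ‖Finsupp.linearCombination 𝕜 x (c.filter fun j => ¬ j ∈ Z)‖ ≤ V + 2 * n * (K * V) := by
    have : Finsupp.linearCombination 𝕜 x (c.filter fun j => ¬ j ∈ Z) =
        Finsupp.linearCombination 𝕜 x c - Finsupp.linearCombination 𝕜 x (c.filter (· ∈ Z)) := by
      rw [linearCombination_filter_add x c (· ∈ Z), add_sub_cancel_left]
    rw [this]
    exact (norm_sub_le _ _).trans (add_le_add le_rfl e2)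
  rw [linearCombination_filter_add (x ∘ f) c (· ∈ Z)]
  calc _ ≤ 2 * n * (K / l * h * V) + m * (V + 2 * n * (K * V)) :=
        (norm_add_le _ _).trans (add_le_add e1 (e3.trans
          (mul_le_mul_of_nonneg_left e4 (Nat.cast_nonneg m))))
    _ ≤ (m * (1 + 2 * n * K) + 2 * n * (K / l * h) + 1) * V := by linarith

end Uniform

/-! ### Suppression, multipliers and the lattice property -/

section Unconditional

variable {𝕜 S : Type*} [RCLike 𝕜] [NormedAddCommGroup S] [Module 𝕜 S] {p : ℝ} {x : ℕ → S}

theorem linearCombination_eq_sum (x : ℕ → S) {c : ℕ →₀ 𝕜} {s : Finset ℕ} (h : c.support ⊆ s) :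
    Finsupp.linearCombination 𝕜 x c = ∑ j ∈ s, c j • x j := by
  rw [Finsupp.linearCombination_apply, Finsupp.sum_of_support_subset _ h]
  simp

variable [ContinuousSMul 𝕜 S] [CompleteSpace S]

/-- Baire makes the basis constant uniform over all reorderings that agree with `π₀` below `n`. A
reordering that lists `A` early turns restriction to `A` into a partial sum projection. -/
theorem IsUnconditionalSeq.exists_suppression (hp : IsPNorm 𝕜 S p) (hx : IsUnconditionalSeq 𝕜 x) :
    ∃ M, 0 < M ∧ ∀ (c : ℕ →₀ 𝕜) (A : Finset ℕ),
      ‖Finsupp.linearCombination 𝕜 x (c.filter (· ∈ A))‖ ≤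
        M * ‖Finsupp.linearCombination 𝕜 x c‖ := by
  classical
  obtain ⟨K, hK, -, hcoef⟩ := hx.1.exists_bound hp
  obtain ⟨m, n, π₀, hπ⟩ := exists_perm_agree
    (F := fun m f => ∀ (c : ℕ →₀ 𝕜) (N : ℕ),
      ‖Finsupp.linearCombination 𝕜 (x ∘ f) (c.filter (· < N))‖ ≤
      m * ‖Finsupp.linearCombination 𝕜 (x ∘ f) c‖) (fun m => by
      simp only [Set.ofPred_forall]
      exact isClosed_iInter fun c => isClosed_iInter fun N =>
        isClosed_le (continuous_linearCombination_comp x _).norm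
          ((continuous_linearCombination_comp x c).norm.const_mul _)) (fun π => by
      obtain ⟨C, -, h, -⟩ := (hx.2 π).exists_bound hp
      obtain ⟨m, hm⟩ := exists_nat_ge C
      exact ⟨m, fun c N => (h c N).trans (mul_le_mul_of_nonneg_right hm (norm_nonneg _))⟩)
  set R := (Finset.range n).image π₀ with hR
  have hRn : R.card ≤ n := Finset.card_image_le.trans_eq (Finset.card_range n)
  have good : ∀ (c : ℕ →₀ 𝕜) (A : Finset ℕ), (∀ i ∈ c.support, i ∉ R) →
      ‖Finsupp.linearCombination 𝕜 x (c.filter (· ∈ A))‖ ≤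
        m * ‖Finsupp.linearCombination 𝕜 x c‖ := by
    intro c A hc
    obtain ⟨a, ha⟩ := A.exists_nat_subset_range
    -- The slots below `n` are reserved for `R`, as agreement with `π₀` requires; `A` goes to `[n, n
    -- + a)` and the rest of the support beyond.
    obtain ⟨ρ, hρ⟩ := exists_perm_extending (R ∪ c.support)
      (fun i => if i ∈ R then π₀.symm i else if i ∈ A then n + i else n + a + i) (by
        have hlt : ∀ i ∈ R, π₀.symm i < n := fun i hi => by
          obtain ⟨j, hj, rfl⟩ := Finset.mem_image.1 hi
          simpa using hj
        intro i _ j _ hij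
        have hA : ∀ i ∈ A, i < a := fun i hi => Finset.mem_range.1 (ha hi)
        simp only at hij
        split_ifs at hij with h1 h2 h3 h4 h5 h6 h7 h8
        · exact π₀.symm.injective hij
        all_goals first
          | omega
          | (have := hlt _ ‹i ∈ R›; omega)
          | (have := hlt _ ‹j ∈ R›; omega)
          | (have := hA _ ‹i ∈ A›; omega)
          | (have := hA _ ‹j ∈ A›; omega))
    have hagree : ∀ i < n, ρ.symm i = π₀ i := fun i hi => by
      have hi' : π₀ i ∈ R := Finset.mem_image_of_mem _ (Finset.mem_range.2 hi)
      rw [Equiv.symm_apply_eq, hρ _ (Finset.mem_union_left _ hi'), if_pos hi',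
        Equiv.symm_apply_apply]
    have h1 := hπ ρ.symm hagree (c.mapDomain ρ) (n + a)
    have e1 : ∀ d : ℕ →₀ 𝕜, Finsupp.linearCombination 𝕜 (x ∘ ρ.symm) d =
        Finsupp.linearCombination 𝕜 x (d.mapDomain ρ.symm) := fun d =>
      (Finsupp.linearCombination_mapDomain 𝕜 _ _).symm
    have e2 : (c.mapDomain ρ).mapDomain ρ.symm = c := by
      rw [← Finsupp.mapDomain_comp]
      simp
    have e3 : ((c.mapDomain ρ).filter (· < n + a)).mapDomain ρ.symm = c.filter (· ∈ A) := by
      rw [← Finsupp.equivMapDomain_eq_mapDomain, ← Finsupp.equivMapDomain_eq_mapDomain]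
      ext j
      rw [Finsupp.equivMapDomain_apply, Finsupp.filter_apply, Finsupp.filter_apply,
        Finsupp.equivMapDomain_apply, Equiv.symm_symm, Equiv.symm_apply_apply]
      by_cases hj : j ∈ c.support
      · rw [hρ j (Finset.mem_union_right _ hj), if_neg (hc j hj)]
        by_cases hjA : j ∈ A
        · have := Finset.mem_range.1 (ha hjA)
          simp [hjA, this]
        · simp [hjA]
      · rw [Finsupp.notMem_support_iff.1 hj]
        simp
    rwa [e1, e1, e2, e3] at h1
  refine ⟨m * (1 + n * K) + n * K + 1, by positivity, fun c A => ?_⟩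
  set V := ‖Finsupp.linearCombination 𝕜 x c‖ with hV
  have hV0 : 0 ≤ V := norm_nonneg _
  have small : ∀ d : ℕ →₀ 𝕜, d.support ⊆ R → (∀ j, ‖d j‖ ^ p * ‖x j‖ ≤ K * V) →
      ‖Finsupp.linearCombination 𝕜 x d‖ ≤ n * (K * V) := fun d hd hM =>
    (hp.norm_linearCombination_le_card x hd hM).trans
      (mul_le_mul_of_nonneg_right (by exact_mod_cast hRn) (by positivity))
  have e2 : ‖Finsupp.linearCombination 𝕜 x (c.filter (· ∈ R))‖ ≤ n * (K * V) :=
    small _ (fun i hi => by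
      rw [Finsupp.support_filter] at hi
      exact (Finset.mem_filter.1 hi).2) (hp.filter_le _ (hcoef c))
  have e4 : ‖Finsupp.linearCombination 𝕜 x (c.filter fun j => ¬ j ∈ R)‖ ≤ V + n * (K * V) := by
    have : Finsupp.linearCombination 𝕜 x (c.filter fun j => ¬ j ∈ R) =
        Finsupp.linearCombination 𝕜 x c - Finsupp.linearCombination 𝕜 x (c.filter (· ∈ R)) := by
      rw [linearCombination_filter_add x c (· ∈ R), add_sub_cancel_left]
    rw [this]
    exact (norm_sub_le _ _).trans (add_le_add le_rfl e2)
  have e5 := good (c.filter fun j => ¬ j ∈ R) A (fun i hi => by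
    rw [Finsupp.support_filter] at hi
    exact (Finset.mem_filter.1 hi).2)
  have e6 : ‖Finsupp.linearCombination 𝕜 x ((c.filter (· ∈ R)).filter (· ∈ A))‖ ≤ n * (K * V) :=
    small _ (fun i hi => by
      rw [Finsupp.support_filter, Finsupp.support_filter] at hi
      exact (Finset.mem_filter.1 (Finset.mem_filter.1 hi).1).2)
      (hp.filter_le _ (hp.filter_le _ (hcoef c)))
  have e7 : c.filter (· ∈ A) = (c.filter (· ∈ R)).filter (· ∈ A) +
      (c.filter fun j => ¬ j ∈ R).filter (· ∈ A) := by
    rw [← Finsupp.filter_add, Finsupp.filter_add_filter_not]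
  rw [e7, map_add]
  calc _ ≤ n * (K * V) + m * (V + n * (K * V)) :=
        (norm_add_le _ _).trans (add_le_add e6 (e5.trans
          (mul_le_mul_of_nonneg_left e4 (Nat.cast_nonneg m))))
    _ ≤ (m * (1 + n * K) + n * K + 1) * V := by linarith

theorem IsUnconditionalSeq.exists_suppression_sum (hp : IsPNorm 𝕜 S p)
    (hx : IsUnconditionalSeq 𝕜 x) : ∃ M, 0 < M ∧ ∀ (a : ℕ → 𝕜) (s A : Finset ℕ), A ⊆ s →
      ‖∑ j ∈ A, a j • x j‖ ≤ M * ‖∑ j ∈ s, a j • x j‖ := by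
  classical
  obtain ⟨M, hM, h⟩ := hx.exists_suppression hp
  refine ⟨M, hM, fun a s A hA => ?_⟩
  have := h (Finsupp.indicator s fun j _ => a j) A
  rw [linearCombination_eq_sum x (Finsupp.support_indicator_subset s _),
    linearCombination_eq_sum x (s := A) (fun i hi => by
      rw [Finsupp.support_filter] at hi
      exact (Finset.mem_filter.1 hi).2)] at this
  rwa [Finset.sum_congr rfl fun j hj => by
      rw [Finsupp.filter_apply_pos _ _ hj, Finsupp.indicator_of_mem (hA hj)],
    Finset.sum_congr (s₁ := s) rfl fun j hj => by rw [Finsupp.indicator_of_mem hj]] at this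

/-- Averaging over subsets is unavailable without convexity. Instead `θ` is expanded in binary: each
digit is a suppression, and the digits are summed with weights `r ^ k`, where `r = 2 ^ (-p) < 1`. -/
theorem IsUnconditionalSeq.exists_multiplier (hp : IsPNorm 𝕜 S p)
    (hx : IsUnconditionalSeq 𝕜 x) : ∃ M, 0 < M ∧ ∀ (d : ℕ → 𝕜) (s : Finset ℕ) (θ : ℕ → ℝ),
      (∀ j, 0 ≤ θ j ∧ θ j ≤ 1) →
      ‖∑ j ∈ s, ((θ j : 𝕜) * d j) • x j‖ ≤ M * ‖∑ j ∈ s, d j • x j‖ := by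
  classical
  obtain ⟨M, hM, h⟩ := hx.exists_suppression_sum hp
  set r : ℝ := (1 / 2) ^ p with hr
  have hr0 : 0 < r := by positivity
  have hr1 : r < 1 := Real.rpow_lt_one (by norm_num) (by norm_num) hp.pos
  have h1r : 0 < 1 - r := by linarith
  have hhalf : ‖(1 / 2 : 𝕜)‖ ^ p = r := by
    rw [hr]
    norm_num
  refine ⟨M / (1 - r), by positivity, fun d s θ hθ => ?_⟩
  set V := ‖∑ j ∈ s, d j • x j‖ with hV
  have hV0 : 0 ≤ V := norm_nonneg _
  set W := ∑ j ∈ s, ‖d j‖ ^ p * ‖x j‖ with hW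
  have claim : ∀ (k : ℕ) (θ : ℕ → ℝ), (∀ j, 0 ≤ θ j ∧ θ j ≤ 1) →
      ‖∑ j ∈ s, ((θ j : 𝕜) * d j) • x j‖ ≤ M / (1 - r) * V + r ^ k * W := by
    intro k
    induction k with
    | zero =>
      intro θ hθ
      have h1 : ‖∑ j ∈ s, ((θ j : 𝕜) * d j) • x j‖ ≤ W := by
        refine (norm_sum_le _ _).trans (Finset.sum_le_sum fun j _ => ?_)
        rw [hp.smul]
        refine mul_le_mul_of_nonneg_right (Real.rpow_le_rpow (norm_nonneg _) ?_ hp.pos.le)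
          (norm_nonneg _)
        rw [norm_mul, RCLike.norm_ofReal, abs_of_nonneg (hθ j).1]
        exact mul_le_of_le_one_left (norm_nonneg _) (hθ j).2
      have h2 : 0 ≤ M / (1 - r) * V := by positivity
      rw [pow_zero, one_mul]
      linarith
    | succ k ih =>
      intro θ hθ
      let A := s.filter fun j => 1 / 2 ≤ θ j
      -- Splitting off the first binary digit: `θ` is half the sum of the indicator of `A` and `θ'`.
      let θ' : ℕ → ℝ := fun j => if 1 / 2 ≤ θ j then 2 * θ j - 1 else 2 * θ j
      have hθ' : ∀ j, 0 ≤ θ' j ∧ θ' j ≤ 1 := fun j => by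
        have := hθ j
        simp only [θ']
        split_ifs <;> constructor <;> linarith
      have hsplit : ∑ j ∈ s, ((θ j : 𝕜) * d j) • x j = (1 / 2 : 𝕜) • (∑ j ∈ A, d j • x j +
          ∑ j ∈ s, ((θ' j : 𝕜) * d j) • x j) := by
        rw [Finset.sum_filter, ← Finset.sum_add_distrib, Finset.smul_sum]
        refine Finset.sum_congr rfl fun j _ => ?_
        simp only [θ']
        split_ifs
        · rw [← add_smul, smul_smul]
          congr 1
          push_cast
          ring
        · rw [zero_add, smul_smul]
          congr 1
          push_cast
          ring
      rw [hsplit, hp.smul, hhalf]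
      have h1 : ‖∑ j ∈ A, d j • x j‖ ≤ M * V := h d s A (Finset.filter_subset _ _)
      calc r * ‖∑ j ∈ A, d j • x j + ∑ j ∈ s, ((θ' j : 𝕜) * d j) • x j‖
          ≤ r * (M * V + (M / (1 - r) * V + r ^ k * W)) :=
            mul_le_mul_of_nonneg_left ((norm_add_le _ _).trans (add_le_add h1 (ih θ' hθ'))) hr0.le
        _ = r * (1 + 1 / (1 - r)) * (M * V) + r ^ (k + 1) * W := by
            field_simp
            ring
        _ ≤ 1 / (1 - r) * (M * V) + r ^ (k + 1) * W := by
            refine add_le_add (mul_le_mul_of_nonneg_right ?_ (by positivity)) le_rfl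
            rw [le_div_iff₀ h1r]
            have : r * (1 + 1 / (1 - r)) * (1 - r) = r * (2 - r) := by field_simp; ring
            rw [this]
            nlinarith [sq_nonneg (1 - r)]
        _ = M / (1 - r) * V + r ^ (k + 1) * W := by ring
  have hlim : Tendsto (fun k : ℕ => M / (1 - r) * V + r ^ k * W) atTop
      (𝓝 (M / (1 - r) * V + 0 * W)) :=
    ((tendsto_pow_atTop_nhds_zero_of_lt_one hr0.le hr1).mul_const W).const_add _
  rw [zero_mul, add_zero] at hlim
  exact ge_of_tendsto' hlim fun k => claim k θ hθ

theorem IsUnconditionalSeq.exists_lattice_bound (hp : IsPNorm 𝕜 S p)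
    (hx : IsUnconditionalSeq 𝕜 x) : ∃ M, 0 < M ∧ ∀ c d : ℕ →₀ 𝕜, (∀ j, ‖c j‖ ≤ ‖d j‖) →
      ‖Finsupp.linearCombination 𝕜 x c‖ ≤ M * ‖Finsupp.linearCombination 𝕜 x d‖ := by
  obtain ⟨M, hM, h⟩ := hx.exists_multiplier hp
  -- One factor `2` comes from positive and negative parts, the other from real and imaginary parts.
  refine ⟨4 * M, by positivity, fun c d hcd => ?_⟩
  have hsupp : c.support ⊆ d.support := fun j hj => by
    rw [Finsupp.mem_support_iff] at hj ⊢
    exact fun h0 => hj (norm_le_zero_iff.1 ((hcd j).trans_eq (by rw [h0, norm_zero])))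
  rw [linearCombination_eq_sum x hsupp, linearCombination_eq_sum x subset_rfl]
  set s := d.support
  set V := ‖∑ j ∈ s, d j • x j‖
  let θ : ℕ → 𝕜 := fun j => c j / d j
  have hθ1 : ∀ j, ‖θ j‖ ≤ 1 := fun j => by
    rw [norm_div]
    exact div_le_one_of_le₀ (hcd j) (norm_nonneg _)
  have hre : ∀ j, |RCLike.re (θ j)| ≤ 1 := fun j => (RCLike.abs_re_le_norm _).trans (hθ1 j)
  have him : ∀ j, |RCLike.im (θ j)| ≤ 1 := fun j => (RCLike.abs_im_le_norm _).trans (hθ1 j)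
  have hpos : ∀ t : ℝ, |t| ≤ 1 → (0 ≤ t⁺ ∧ t⁺ ≤ 1) ∧ (0 ≤ t⁻ ∧ t⁻ ≤ 1) := fun t ht =>
    ⟨⟨posPart_nonneg t, by
      rw [posPart_def]; exact sup_le ((le_abs_self t).trans ht) zero_le_one⟩,
      negPart_nonneg t, by
      rw [negPart_def]; exact sup_le ((neg_le_abs t).trans ht) zero_le_one⟩
  have hreal : ∀ t : ℕ → ℝ, (∀ j, |t j| ≤ 1) → ‖∑ j ∈ s, ((t j : 𝕜) * d j) • x j‖ ≤ 2 * M * V := by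
    intro t ht
    have : ∑ j ∈ s, ((t j : 𝕜) * d j) • x j = ∑ j ∈ s, (((t j)⁺ : ℝ) * d j : 𝕜) • x j -
        ∑ j ∈ s, (((t j)⁻ : ℝ) * d j : 𝕜) • x j := by
      rw [← Finset.sum_sub_distrib]
      refine Finset.sum_congr rfl fun j _ => ?_
      rw [← sub_smul, ← sub_mul, ← RCLike.ofReal_sub, posPart_sub_negPart]
    rw [this]
    have h1 := h d s (fun j => (t j)⁺) fun j => (hpos _ (ht j)).1
    have h2 := h d s (fun j => (t j)⁻) fun j => (hpos _ (ht j)).2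
    exact (norm_sub_le _ _).trans ((add_le_add h1 h2).trans_eq (by ring))
  have hsplit : ∑ j ∈ s, c j • x j = ∑ j ∈ s, ((RCLike.re (θ j) : 𝕜) * d j) • x j +
      (RCLike.I : 𝕜) • ∑ j ∈ s, ((RCLike.im (θ j) : 𝕜) * d j) • x j := by
    rw [Finset.smul_sum, ← Finset.sum_add_distrib]
    refine Finset.sum_congr rfl fun j hj => ?_
    rw [smul_smul, ← add_smul]
    congr 1
    have hd : d j ≠ 0 := Finsupp.mem_support_iff.1 hj
    calc c j = θ j * d j := (div_mul_cancel₀ _ hd).symm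
      _ = ((RCLike.re (θ j) : 𝕜) + (RCLike.im (θ j) : 𝕜) * RCLike.I) * d j := by
        rw [RCLike.re_add_im]
      _ = _ := by ring
  have hI : ‖(RCLike.I : 𝕜)‖ ^ p ≤ 1 := by
    refine Real.rpow_le_one (norm_nonneg _) ?_ hp.pos.le
    by_cases h0 : (RCLike.I : 𝕜) = 0
    · rw [h0, norm_zero]; exact zero_le_one
    · rw [RCLike.norm_I_of_ne_zero h0]
  rw [hsplit]
  refine (norm_add_le _ _).trans ?_
  rw [hp.smul]
  have h1 := hreal _ hre
  have h2 := hreal _ him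
  have h3 := mul_le_of_le_one_left (norm_nonneg (∑ j ∈ s, ((RCLike.im (θ j) : 𝕜) * d j) • x j)) hI
  linarith

/-- Extend `f` to a permutation, move `c` along it at a uniform cost, and compare coordinatewise.
This is the form in which symmetry is used in most of what follows. -/
theorem IsSymmetricSeq.exists_domination (hp : IsPNorm 𝕜 S p) (hx : IsSymmetricSeq 𝕜 x) :
    ∃ C, 0 < C ∧ ∀ (c d : ℕ →₀ 𝕜) (f : ℕ → ℕ), Set.InjOn f c.support →
      (∀ j ∈ c.support, ‖c j‖ ≤ ‖d (f j)‖) →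
      ‖Finsupp.linearCombination 𝕜 x c‖ ≤ C * ‖Finsupp.linearCombination 𝕜 x d‖ := by
  obtain ⟨C, hC, h⟩ := (hx.exists_uniform_bound hp).2
  obtain ⟨M, hM, hl⟩ := hx.isUnconditionalSeq.exists_lattice_bound hp
  refine ⟨C * M, by positivity, fun c d f hf hcd => ?_⟩
  obtain ⟨π, hπ⟩ := exists_perm_extending c.support f hf
  have h1 := h (c.mapDomain π) π.symm π.symm.injective.injOn
  rw [← Finsupp.linearCombination_mapDomain, ← Finsupp.mapDomain_comp, Equiv.symm_comp_self,
    Finsupp.mapDomain_id] at h1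
  refine h1.trans ?_
  rw [mul_assoc]
  refine mul_le_mul_of_nonneg_left (hl _ _ fun j => ?_) hC.le
  rw [← Finsupp.equivMapDomain_eq_mapDomain, Finsupp.equivMapDomain_apply]
  by_cases hj : π.symm j ∈ c.support
  · refine (hcd _ hj).trans_eq ?_
    rw [← hπ _ hj, Equiv.apply_symm_apply]
  · rw [Finsupp.notMem_support_iff.1 hj, norm_zero]
    exact norm_nonneg _

end Unconditional

/-! ### Disjoint rows, perturbations and subsymmetric sequences -/

section Rows

variable {𝕜 S : Type*} [RCLike 𝕜] [NormedAddCommGroup S] [Module 𝕜 S] {p : ℝ} {s x y : ℕ → S}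

/-- The finitely supported vectors `u k` have pairwise disjoint supports. -/
def DisjointRows (u : ℕ → ℕ →₀ 𝕜) : Prop :=
  ∀ k l j, j ∈ (u k).support → j ∈ (u l).support → k = l

theorem linearCombination_rows (s : ℕ → S) (u : ℕ → ℕ →₀ 𝕜) (c : ℕ →₀ 𝕜) :
    Finsupp.linearCombination 𝕜 (fun k => Finsupp.linearCombination 𝕜 s (u k)) c =
      Finsupp.linearCombination 𝕜 s (Finsupp.linearCombination 𝕜 u c) :=
  (Finsupp.apply_linearCombination 𝕜 (Finsupp.linearCombination 𝕜 s) u c).symm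

theorem DisjointRows.apply {u : ℕ → ℕ →₀ 𝕜} (hu : DisjointRows u) (c : ℕ →₀ 𝕜) {k j : ℕ}
    (hj : j ∈ (u k).support) : Finsupp.linearCombination 𝕜 u c j = c k * u k j := by
  rw [Finsupp.linearCombination_apply, Finsupp.sum, Finsupp.finsetSum_apply,
    Finset.sum_eq_single k]
  · simp
  · intro l _ hl
    have : j ∉ (u l).support := fun h => hl (hu l k j h hj)
    simp [Finsupp.notMem_support_iff.1 this]
  · intro hk
    simp [Finsupp.notMem_support_iff.1 hk]

theorem exists_row_of_mem_support {u : ℕ → ℕ →₀ 𝕜} {c : ℕ →₀ 𝕜} {j : ℕ}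
    (hj : j ∈ (Finsupp.linearCombination 𝕜 u c).support) : ∃ k, j ∈ (u k).support := by
  by_contra! h
  refine Finsupp.mem_support_iff.1 hj ?_
  rw [Finsupp.linearCombination_apply, Finsupp.sum, Finsupp.finsetSum_apply]
  exact Finset.sum_eq_zero fun k _ => by simp [Finsupp.notMem_support_iff.1 (h k)]

theorem DisjointRows.comp {u : ℕ → ℕ →₀ 𝕜} (hu : DisjointRows u) {f : ℕ → ℕ}
    (hf : Function.Injective f) : DisjointRows (u ∘ f) :=
  fun _ _ j hk hl => hf (hu _ _ j hk hl)

theorem disjointRows_of_Ico {u : ℕ → ℕ →₀ 𝕜} {N : ℕ → ℕ} (hN : Monotone N)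
    (hu : ∀ k, (u k).support ⊆ Finset.Ico (N k) (N (k + 1))) : DisjointRows u := by
  intro k l j hk hl
  have h1 := Finset.mem_Ico.1 (hu k hk)
  have h2 := Finset.mem_Ico.1 (hu l hl)
  rcases lt_trichotomy k l with h | h | h
  · have := hN (Nat.succ_le_of_lt h)
    simp only [Nat.succ_eq_add_one] at this
    omega
  · exact h
  · have := hN (Nat.succ_le_of_lt h)
    simp only [Nat.succ_eq_add_one] at this
    omega

variable [ContinuousSMul 𝕜 S] [CompleteSpace S]

/-- Disjoint rows whose entries can be injected, row by row, into larger entries of other disjoint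
rows are dominated by these. -/
theorem IsSymmetricSeq.exists_rows_bound (hp : IsPNorm 𝕜 S p) (hs : IsSymmetricSeq 𝕜 s) :
    ∃ C, 0 < C ∧ ∀ (u w : ℕ → ℕ →₀ 𝕜) (f : ℕ → ℕ → ℕ), DisjointRows u → DisjointRows w →
      (∀ k, Set.InjOn (f k) (u k).support) →
      (∀ k, ∀ j ∈ (u k).support, ‖u k j‖ ≤ ‖w k (f k j)‖) → ∀ c : ℕ →₀ 𝕜,
      ‖Finsupp.linearCombination 𝕜 (fun k => Finsupp.linearCombination 𝕜 s (u k)) c‖ ≤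
        C * ‖Finsupp.linearCombination 𝕜 (fun k => Finsupp.linearCombination 𝕜 s (w k)) c‖ := by
  obtain ⟨C, hC, h⟩ := hs.exists_domination hp
  refine ⟨C, hC, fun u w f hu hw hf huw c => ?_⟩
  rw [linearCombination_rows, linearCombination_rows]
  have hex : ∀ j, ∃ k, j ∈ (Finsupp.linearCombination 𝕜 u c).support → j ∈ (u k).support :=
    fun j => by
      by_cases hj : j ∈ (Finsupp.linearCombination 𝕜 u c).support
      · obtain ⟨k, hk⟩ := exists_row_of_mem_support hj
        exact ⟨k, fun _ => hk⟩
      · exact ⟨0, fun h => absurd h hj⟩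
  -- `κ j` is the row containing `j`. The row injections glue to a global one because the target
  -- rows are disjoint.
  choose κ hκ using hex
  have hw' : ∀ k, ∀ j ∈ (u k).support, f k j ∈ (w k).support := fun k j hj => by
    rw [Finsupp.mem_support_iff] at hj ⊢
    intro h0
    have := huw k j (Finsupp.mem_support_iff.2 hj)
    rw [h0, norm_zero] at this
    exact hj (norm_le_zero_iff.1 this)
  refine h _ _ (fun j => f (κ j) j) ?_ fun j hj => ?_
  · intro i hi j hj hij
    have h1 := hw' _ _ (hκ i hi)
    have h2 := hw' _ _ (hκ j hj)
    simp only at hij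
    rw [hij] at h1
    have h3 : κ i = κ j := hw _ _ _ h1 h2
    rw [← h3] at hij
    exact hf (κ i) (hκ i hi) (h3 ▸ hκ j hj) hij
  · rw [hu.apply c (hκ j hj), hw.apply c (hw' _ _ (hκ j hj)), norm_mul, norm_mul]
    exact mul_le_mul_of_nonneg_left (huw _ _ (hκ j hj)) (norm_nonneg _)

/-- The principle of small perturbations: the errors add up to at most half the norm of the
combination of the `x k`. -/
theorem seqEquivalent_of_perturbation (hp : IsPNorm 𝕜 S p) {A : ℝ} (hA : 0 < A)
    (hx : ∀ (c : ℕ →₀ 𝕜) (k : ℕ), ‖c k‖ ^ p ≤ A * ‖Finsupp.linearCombination 𝕜 x c‖)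
    (hxy : ∀ k, ‖x k - y k‖ ≤ 1 / (4 * A) * (1 / 2) ^ k) : SeqEquivalent 𝕜 x y := by
  have key : ∀ c : ℕ →₀ 𝕜, ‖Finsupp.linearCombination 𝕜 x c - Finsupp.linearCombination 𝕜 y c‖ ≤
      1 / 2 * ‖Finsupp.linearCombination 𝕜 x c‖ := by
    intro c
    set V := ‖Finsupp.linearCombination 𝕜 x c‖
    have h1 : Finsupp.linearCombination 𝕜 x c - Finsupp.linearCombination 𝕜 y c =
        Finsupp.linearCombination 𝕜 (x - y) c := by
      simp only [Finsupp.linearCombination_apply, Finsupp.sum, Pi.sub_apply, smul_sub,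
        Finset.sum_sub_distrib]
    rw [h1]
    calc ‖Finsupp.linearCombination 𝕜 (x - y) c‖
        ≤ ∑ k ∈ c.support, ‖c k‖ ^ p * ‖(x - y) k‖ := hp.norm_linearCombination_le _ _
      _ ≤ ∑ k ∈ c.support, V / 4 * (1 / 2) ^ k := Finset.sum_le_sum fun k _ => by
          calc ‖c k‖ ^ p * ‖(x - y) k‖ ≤ (A * V) * (1 / (4 * A) * (1 / 2) ^ k) :=
                mul_le_mul (hx c k) (hxy k) (norm_nonneg _) (by positivity)
            _ = V / 4 * (1 / 2) ^ k := by field_simp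
      _ ≤ V / 4 * 2 := by
          rw [← Finset.mul_sum]
          refine mul_le_mul_of_nonneg_left ?_ (by positivity)
          exact (summable_geometric_two.sum_le_tsum _ fun k _ => by positivity).trans_eq
            tsum_geometric_two
      _ = 1 / 2 * V := by ring
  constructor
  · refine dominates_of_bound hp (C := 3 / 2) fun c => ?_
    have := norm_sub_norm_le (Finsupp.linearCombination 𝕜 y c) (Finsupp.linearCombination 𝕜 x c)
    rw [norm_sub_rev] at this
    linarith [key c]
  · refine dominates_of_bound hp (C := 2) fun c => ?_
    have := norm_sub_norm_le (Finsupp.linearCombination 𝕜 x c) (Finsupp.linearCombination 𝕜 y c)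
    linarith [key c]

/-- If `t` were unbounded, a subsequence could be chosen with `t (φ n) > n * t n`. Applied to norms
and to their inverses, this makes subsymmetric sequences semi-normalized. -/
theorem bddAbove_of_subsequence_bound {t : ℕ → ℝ} (ht : ∀ n, 0 < t n)
    (h : ∀ φ : ℕ → ℕ, StrictMono φ → ∃ C, ∀ n, t (φ n) ≤ C * t n) : BddAbove (Set.range t) := by
  by_contra hb
  have hfreq : ∀ n : ℕ, ∃ᶠ k in atTop, (n : ℝ) * t n < t k := by
    intro n hn
    simp only [not_lt] at hn
    exact hb (Filter.IsBoundedUnder.bddAbove_range ⟨n * t n, by simpa using hn⟩)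
  obtain ⟨φ, hφ, hφt⟩ := extraction_forall_of_frequently hfreq
  obtain ⟨C, hC⟩ := h φ hφ
  obtain ⟨n, hn⟩ := exists_nat_ge C
  have := mul_le_mul_of_nonneg_right hn (ht n).le
  linarith [hφt n, hC n]

theorem IsSubsymmetricSeq.exists_norm_bounds (hp : IsPNorm 𝕜 S p) (hx : IsSubsymmetricSeq 𝕜 x) :
    ∃ l h, 0 < l ∧ ∀ k, l ≤ ‖x k‖ ∧ ‖x k‖ ≤ h := by
  have hpos : ∀ k, 0 < ‖x k‖ := fun k => norm_pos_iff.2 (hx.1.1.ne_zero k)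
  obtain ⟨h, hh⟩ := bddAbove_of_subsequence_bound hpos fun φ hφ => by
    obtain ⟨C, -, hC⟩ := (dominates_iff hp).1 (hx.2 φ hφ).2
    exact ⟨C, fun n => by simpa using hC (Finsupp.single n 1)⟩
  obtain ⟨l, hl⟩ := bddAbove_of_subsequence_bound (fun k => inv_pos.2 (hpos k)) fun φ hφ => by
    obtain ⟨C, hC0, hC⟩ := (dominates_iff hp).1 (hx.2 φ hφ).1
    refine ⟨C, fun n => ?_⟩
    have : ‖x n‖ ≤ C * ‖x (φ n)‖ := by simpa using hC (Finsupp.single n 1)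
    rw [← div_eq_mul_inv, le_div_iff₀ (hpos _), inv_mul_le_iff₀ (hpos _), mul_comm]
    exact this
  have hl0 : 0 < l := (inv_pos.2 (hpos 0)).trans_le (hl ⟨0, rfl⟩)
  exact ⟨l⁻¹, h, inv_pos.2 hl0, fun k => ⟨inv_le_of_inv_le₀ (hpos k) (hl ⟨k, rfl⟩), hh ⟨k, rfl⟩⟩⟩

theorem IsBasicSeq.exists_coeff_bound (hp : IsPNorm 𝕜 S p) (hx : IsBasicSeq 𝕜 x) {l : ℝ}
    (hl : 0 < l) (hlx : ∀ k, l ≤ ‖x k‖) : ∃ A, 0 < A ∧ ∀ (c : ℕ →₀ 𝕜) (k : ℕ),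
      ‖c k‖ ^ p ≤ A * ‖Finsupp.linearCombination 𝕜 x c‖ := by
  obtain ⟨K, hK, -, h⟩ := hx.exists_bound hp
  refine ⟨K / l, by positivity, fun c k => ?_⟩
  rw [div_mul_eq_mul_div, le_div_iff₀ hl]
  exact (mul_le_mul_of_nonneg_left (hlx k) (by positivity)).trans (h c k)

/-- The terms `x (ψ k)` can be deleted by the lattice property, since the two ranges are disjoint;
this leaves `x ∘ φ`. -/
theorem IsSubsymmetricSeq.seqEquivalent_differences (hp : IsPNorm 𝕜 S p)
    (hx : IsSubsymmetricSeq 𝕜 x) {φ ψ : ℕ → ℕ} (hφ : StrictMono φ) (hψ : StrictMono ψ)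
    (hφψ : ∀ i j, φ i ≠ ψ j) : SeqEquivalent 𝕜 x (fun k => x (φ k) - x (ψ k)) := by
  have hL : ∀ c : ℕ →₀ 𝕜, Finsupp.linearCombination 𝕜 (fun k => x (φ k) - x (ψ k)) c =
      Finsupp.linearCombination 𝕜 (x ∘ φ) c - Finsupp.linearCombination 𝕜 (x ∘ ψ) c := fun c => by
    simp only [Finsupp.linearCombination_apply, Finsupp.sum, smul_sub, Finset.sum_sub_distrib,
      Function.comp_apply]
  constructor
  · obtain ⟨C, -, hC⟩ := (dominates_iff hp).1 (hx.2 φ hφ).2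
    obtain ⟨D, -, hD⟩ := (dominates_iff hp).1 (hx.2 ψ hψ).2
    refine dominates_of_bound hp (C := C + D) fun c => ?_
    rw [hL, add_mul]
    exact (norm_sub_le _ _).trans (add_le_add (hC c) (hD c))
  · obtain ⟨M, -, hM⟩ := hx.1.exists_lattice_bound hp
    refine Dominates.trans (y := x ∘ φ) (dominates_of_bound hp (C := M) fun c => ?_) (hx.2 φ hφ).1
    rw [hL, ← Finsupp.linearCombination_mapDomain, ← Finsupp.linearCombination_mapDomain, ← map_sub]
    refine hM _ _ fun j => ?_
    rw [Finsupp.sub_apply]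
    by_cases hj : j ∈ Set.range φ
    · rw [Finsupp.mapDomain_of_notMem_range c j (f := ψ), sub_zero]
      rintro ⟨i, hi⟩
      obtain ⟨k, hk⟩ := hj
      exact hφψ k i (hk.trans hi.symm)
    · rw [Finsupp.mapDomain_of_notMem_range c j hj, norm_zero]
      exact norm_nonneg _

end Rows

/-! ### Reduction to block sequences by a gliding hump -/

section Blocks

variable {𝕜 S : Type*} [RCLike 𝕜] [NormedAddCommGroup S] [Module 𝕜 S] {p : ℝ} {s x : ℕ → S}
  (hs : IsSchauderBasis 𝕜 s)

/-- The coefficients of `v` with indices in `[m, n)`. -/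
def IsSchauderBasis.truncate (m n : ℕ) (v : S) : ℕ →₀ 𝕜 :=
  Finsupp.indicator (Finset.Ico m n) fun j _ => hs.coeff v j

theorem IsSchauderBasis.truncate_support (m n : ℕ) (v : S) :
    (hs.truncate m n v).support ⊆ Finset.Ico m n :=
  Finsupp.support_indicator_subset _ _

theorem IsSchauderBasis.linearCombination_truncate {m n : ℕ} (h : m ≤ n) (v : S) :
    Finsupp.linearCombination 𝕜 s (hs.truncate m n v) = hs.proj n v - hs.proj m v := by
  rw [linearCombination_eq_sum s (hs.truncate_support m n v), proj, proj,
    ← Finset.sum_Ico_eq_sub _ h]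
  exact Finset.sum_congr rfl fun j hj => by
    rw [truncate, Finsupp.indicator_of_mem hj]

theorem IsSchauderBasis.linearCombination_truncate_zero (n : ℕ) (v : S) :
    Finsupp.linearCombination 𝕜 s (hs.truncate 0 n v) =
      ∑ j ∈ Finset.range n, hs.coeff v j • s j := by
  rw [hs.linearCombination_truncate (Nat.zero_le n), proj, proj, Finset.sum_range_zero, sub_zero]

theorem isBlockBasic_of_Ico {u : ℕ → ℕ →₀ 𝕜} {N : ℕ → ℕ}
    (hu : ∀ k, (u k).support ⊆ Finset.Ico (N k) (N (k + 1)))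
    (h0 : ∀ k, Finsupp.linearCombination 𝕜 s (u k) ≠ 0) :
    IsBlockBasic hs (fun k => Finsupp.linearCombination 𝕜 s (u k)) := by
  refine ⟨h0, fun k i j hi hj => ?_⟩
  rw [hs.coeff_linearCombination] at hi hj
  have h1 := Finset.mem_Ico.1 (hu k (Finsupp.mem_support_iff.2 hi))
  have h2 := Finset.mem_Ico.1 (hu (k + 1) (Finsupp.mem_support_iff.2 hj))
  omega

variable [ContinuousSMul 𝕜 S] [CompleteSpace S]

theorem IsSchauderBasis.exists_coeff_bound (hp : IsPNorm 𝕜 S p) {l : ℝ} (hl : 0 < l)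
    (hls : ∀ k, l ≤ ‖s k‖) : ∃ A, 0 < A ∧ ∀ (v : S) (j : ℕ), ‖hs.coeff v j‖ ^ p ≤ A * ‖v‖ := by
  obtain ⟨K, hK, h⟩ := hs.exists_proj_bound hp
  refine ⟨2 * K / l, by positivity, fun v j => ?_⟩
  have := hs.norm_coeff_smul_le (h v) j
  rw [hp.smul] at this
  rw [div_mul_eq_mul_div, le_div_iff₀ hl]
  have h2 := mul_le_mul_of_nonneg_left (hls j) (Real.rpow_nonneg (norm_nonneg (hs.coeff v j)) p)
  linarith

theorem exists_subseq_tendsto {a : ℕ → ℕ → 𝕜} {M : ℝ} (h : ∀ k j, ‖a k j‖ ≤ M) :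
    ∃ (b : ℕ → 𝕜) (φ : ℕ → ℕ), StrictMono φ ∧
      ∀ j, Tendsto (fun k => a (φ k) j) atTop (𝓝 (b j)) := by
  have hc : IsCompact (Set.univ.pi fun _ : ℕ => Metric.closedBall (0 : 𝕜) M) :=
    isCompact_univ_pi fun _ => isCompact_closedBall 0 M
  obtain ⟨b, -, φ, hφ, hb⟩ := hc.tendsto_subseq (x := a) fun k j _ => by simpa using h k j
  exact ⟨b, φ, hφ, fun j => (tendsto_pi_nhds.1 hb) j⟩

/-- Coordinatewise null semi-normalized basic sequences have subsequences equivalent to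
block sequences. -/
theorem IsSchauderBasis.exists_block_subsequence (hp : IsPNorm 𝕜 S p) {A : ℝ} (hA : 0 < A)
    (hx : ∀ (c : ℕ →₀ 𝕜) (k : ℕ), ‖c k‖ ^ p ≤ A * ‖Finsupp.linearCombination 𝕜 x c‖)
    (hnull : ∀ j, Tendsto (fun k => hs.coeff (x k) j) atTop (𝓝 0)) :
    ∃ (ψ N : ℕ → ℕ) (u : ℕ → ℕ →₀ 𝕜), StrictMono ψ ∧ StrictMono N ∧
      (∀ k, (u k).support ⊆ Finset.Ico (N k) (N (k + 1))) ∧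
      SeqEquivalent 𝕜 (x ∘ ψ) (fun k => Finsupp.linearCombination 𝕜 s (u k)) := by
  have hproj : ∀ n, Tendsto (fun k => hs.proj n (x k)) atTop (𝓝 0) := fun n => by
    have := tendsto_finsetSum (Finset.range n) fun j _ => (hnull j).smul_const (s j)
    simpa [proj] using this
  -- The hump: a late term is small on `[0, n)` by coordinatewise nullity, and small beyond some
  -- `n'` by convergence of its expansion.
  have step : ∀ (ε : ℝ) (k n : ℕ), 0 < ε → ∃ k' n', k < k' ∧ n < n' ∧
      ‖x k' - (hs.proj n' (x k') - hs.proj n (x k'))‖ ≤ ε := by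
    intro ε k n hε
    obtain ⟨k', hk', hkk'⟩ := (((Metric.tendsto_nhds.1 (hproj n)) (ε / 2) (half_pos hε)).and
      (eventually_gt_atTop k)).exists
    obtain ⟨n', hn', hnn'⟩ := (((Metric.tendsto_nhds.1 (hs.tendsto_proj (x k'))) (ε / 2)
      (half_pos hε)).and (eventually_gt_atTop n)).exists
    refine ⟨k', n', hkk', hnn', ?_⟩
    rw [dist_zero_right] at hk'
    rw [dist_eq_norm, norm_sub_rev] at hn'
    have : x k' - (hs.proj n' (x k') - hs.proj n (x k')) =
      (x k' - hs.proj n' (x k')) + hs.proj n (x k') := by abel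
    rw [this]
    linarith [norm_add_le (x k' - hs.proj n' (x k')) (hs.proj n (x k'))]
  choose! fk fn hk hn hkn using step
  let ε : ℕ → ℝ := fun m => 1 / (4 * A) * (1 / 2) ^ m
  have hε : ∀ m, 0 < ε m := fun m => by positivity
  let seq : ℕ → ℕ × ℕ := fun m => Nat.rec (0, 0) (fun m z => (fk (ε m) z.1 z.2, fn (ε m) z.1 z.2)) m
  have hN : StrictMono fun m => (seq m).2 := strictMono_nat_of_lt_succ fun m => hn _ _ _ (hε m)
  refine ⟨fun m => (seq (m + 1)).1, fun m => (seq m).2,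
    fun m => hs.truncate (seq m).2 (seq (m + 1)).2 (x (seq (m + 1)).1),
    strictMono_nat_of_lt_succ fun m => hk _ _ _ (hε (m + 1)), hN,
    fun k => hs.truncate_support _ _ _, ?_⟩
  have hinj : Function.Injective fun m => (seq (m + 1)).1 :=
    (strictMono_nat_of_lt_succ fun m => hk _ _ _ (hε (m + 1))).injective
  refine seqEquivalent_of_perturbation hp hA (fun c k => ?_) fun m => ?_
  · have := hx (c.mapDomain fun m => (seq (m + 1)).1) (seq (k + 1)).1
    rwa [Finsupp.mapDomain_apply hinj, Finsupp.linearCombination_mapDomain] at this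
  · rw [hs.linearCombination_truncate (hN m.lt_succ_self).le]
    exact hkn _ _ _ (hε m)

/-- A coordinatewise limit of a subsequence of `x` need not come from a vector of `S`, so it cannot
simply be subtracted. Differences of consecutive terms cancel it, and subsymmetry keeps them
equivalent to `x`. -/
theorem IsSchauderBasis.exists_equivalent_block (hs : IsSchauderBasis 𝕜 s) (hp : IsPNorm 𝕜 S p) (hsym : IsSymmetricSeq 𝕜 s)
    (hx : IsSubsymmetricSeq 𝕜 x) : ∃ (N : ℕ → ℕ) (u : ℕ → ℕ →₀ 𝕜), StrictMono N ∧
      (∀ k, (u k).support ⊆ Finset.Ico (N k) (N (k + 1))) ∧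
      SeqEquivalent 𝕜 x (fun k => Finsupp.linearCombination 𝕜 s (u k)) := by
  obtain ⟨l, h, hl, hlh⟩ := hx.exists_norm_bounds hp
  obtain ⟨l', h', hl', hlh'⟩ := (hsym.exists_uniform_bound hp).1
  obtain ⟨A, hA, hcoef⟩ := hs.exists_coeff_bound hp hl' fun k => (hlh' k).1
  obtain ⟨a, φ, hφ, ha⟩ := exists_subseq_tendsto (a := fun k => hs.coeff (x k))
    (M := (A * h) ^ p⁻¹) fun k j => by
      have h1 := (hcoef (x k) j).trans (mul_le_mul_of_nonneg_left (hlh k).2 hA.le)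
      have h2 := Real.rpow_le_rpow (by positivity) h1 (inv_pos.2 hp.pos).le
      rwa [Real.rpow_rpow_inv (norm_nonneg _) hp.pos.ne'] at h2
  have he := hx.seqEquivalent_differences hp (φ := fun k => φ (2 * k))
    (ψ := fun k => φ (2 * k + 1)) (fun i j hij => hφ (by omega)) (fun i j hij => hφ (by omega))
    (fun i j hij => by have := hφ.injective hij; omega)
  set y : ℕ → S := fun k => x (φ (2 * k)) - x (φ (2 * k + 1)) with hy
  have hys := he.isSubsymmetricSeq hp hx
  obtain ⟨ly, hhy, hly, hlhy⟩ := hys.exists_norm_bounds hp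
  obtain ⟨A', hA', hy'⟩ := hys.1.1.exists_coeff_bound hp hly fun k => (hlhy k).1
  obtain ⟨ψ, N, u, hψ, hN, hu, heq⟩ := hs.exists_block_subsequence hp hA' hy' fun j => by
    have h1 : Tendsto (fun k : ℕ => 2 * k) atTop atTop :=
      tendsto_atTop_mono (fun k => by simp only [id]; omega) tendsto_id
    have h2 : Tendsto (fun k : ℕ => 2 * k + 1) atTop atTop :=
      tendsto_atTop_mono (fun k => by simp only [id]; omega) tendsto_id
    have := ((ha j).comp h1).sub ((ha j).comp h2)
    rw [sub_self] at this
    refine this.congr fun k => ?_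
    simp [hy, hs.coeff_sub]
  exact ⟨N, u, hN, hu, (he.trans (hys.2 ψ hψ).symm).trans heq⟩

end Blocks

/-! ### Decreasing rearrangements and placement in intervals -/

section Combinatorics

variable {𝕜 S : Type*} [RCLike 𝕜] [NormedAddCommGroup S] [Module 𝕜 S] {p : ℝ} {s x : ℕ → S}

theorem exists_perm_antitone (u : ℕ →₀ 𝕜) :
    ∃ σ : Equiv.Perm ℕ, Antitone fun j => ‖u (σ j)‖ := by
  obtain ⟨N, hN⟩ := u.support.exists_nat_subset_range
  let f : Fin N → ℝ := fun i => -‖u i‖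
  have hmono := Tuple.monotone_sort f
  let e : Equiv.Perm {i // i < N} := Fin.equivSubtype.symm.trans
    ((Tuple.sort f).trans Fin.equivSubtype)
  refine ⟨e.extendDomain (Equiv.refl {i // i < N}), fun i j hij => ?_⟩
  rcases lt_or_ge j N with hj | hj
  · have hi : i < N := hij.trans_lt hj
    have e1 := Equiv.Perm.extendDomain_apply_subtype e (Equiv.refl {i // i < N}) hi
    have e2 := Equiv.Perm.extendDomain_apply_subtype e (Equiv.refl {i // i < N}) hj
    have := hmono (show (⟨i, hi⟩ : Fin N) ≤ ⟨j, hj⟩ from hij)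
    simp only [f, Function.comp_apply] at this
    simp only [e1, e2]
    exact neg_le_neg_iff.1 this
  · have e2 := Equiv.Perm.extendDomain_apply_not_subtype e (Equiv.refl {i // i < N}) hj.not_gt
    have h0 : u j = 0 := Finsupp.notMem_support_iff.1 fun h => by
      have := Finset.mem_range.1 (hN h)
      omega
    simp only [e2, h0, norm_zero]
    exact norm_nonneg _

theorem mapDomain_add_support {w : ℕ →₀ 𝕜} {n l : ℕ} (hw : w.support ⊆ Finset.range l) :
    (w.mapDomain (n + ·)).support ⊆ Finset.Ico n (n + l) := by
  classical
  intro i hi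
  obtain ⟨j, hj, rfl⟩ := Finset.mem_image.1 (Finsupp.mapDomain_support hi)
  have := Finset.mem_range.1 (hw hj)
  rw [Finset.mem_Ico]
  omega

theorem exists_placement {v w : ℕ → ℕ →₀ 𝕜} : ∃ N : ℕ → ℕ, Monotone N ∧ ∀ k,
    ((v k).mapDomain (N k + ·)).support ⊆ Finset.Ico (N k) (N (k + 1)) ∧
    ((w k).mapDomain (N k + ·)).support ⊆ Finset.Ico (N k) (N (k + 1)) := by
  classical
  have h : ∀ k, ∃ l, (v k).support ∪ (w k).support ⊆ Finset.range l := fun k =>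
    Finset.exists_nat_subset_range _
  choose l hl using h
  refine ⟨fun k => ∑ i ∈ Finset.range k, l i, fun i j hij =>
    Finset.sum_le_sum_of_subset (Finset.range_mono hij), fun k => ?_⟩
  simp only [Finset.sum_range_succ]
  exact ⟨mapDomain_add_support (Finset.union_subset_left (hl k)),
    mapDomain_add_support (Finset.union_subset_right (hl k))⟩

end Combinatorics

/-! ### Right-shifts, uniformly null sequences, sequences with bounded sums -/

section Generated

variable {𝕜 S : Type*} [RCLike 𝕜] [NormedAddCommGroup S] [Module 𝕜 S] {p : ℝ} {s x : ℕ → S}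
  (hs : IsSchauderBasis 𝕜 s)

theorem seriesTendsto_linearCombination (x : ℕ → S) (c : ℕ →₀ 𝕜) :
    SeriesTendsto 𝕜 x c (Finsupp.linearCombination 𝕜 x c) := by
  refine tendsto_const_nhds.congr' ?_
  obtain ⟨N, hN⟩ := c.support.exists_nat_subset_range
  filter_upwards [eventually_ge_atTop N] with n hn
  exact linearCombination_eq_sum _ (hN.trans (Finset.range_mono hn))

theorem isRightShift_linearCombination {φ : ℕ → ℕ} (hφ : StrictMono φ) (c : ℕ →₀ 𝕜) :
    IsRightShift hs (Finsupp.linearCombination 𝕜 s c) (Finsupp.linearCombination 𝕜 (s ∘ φ) c) := by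
  refine ⟨φ, hφ, ?_⟩
  rw [hs.coeff_linearCombination]
  exact seriesTendsto_linearCombination _ c

theorem isUniformlyNull_of_le {z : ℕ → S} {t : ℕ → ℝ} (ht : Tendsto t atTop (𝓝 0))
    (h : ∀ k j, ‖hs.coeff (z k) j‖ ≤ t k) : IsUniformlyNull hs z := by
  have h1 : Tendsto (fun k => ENNReal.ofReal (t k)) atTop (𝓝 0) := by
    simpa using ENNReal.tendsto_ofReal ht
  refine tendsto_of_tendsto_of_tendsto_of_le_of_le tendsto_const_nhds h1 (fun _ => zero_le)
    fun k => iSup_le fun j => ?_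
  rw [← ofReal_norm]
  exact ENNReal.ofReal_le_ofReal (h k j)

theorem IsSchauderBasis.tendsto_coeff_zero (hp : IsPNorm 𝕜 S p) {l : ℝ} (hl : 0 < l)
    (hls : ∀ k, l ≤ ‖s k‖) (v : S) : Tendsto (hs.coeff v) atTop (𝓝 0) := by
  have h1 : Tendsto (fun n => hs.coeff v n • s n) atTop (𝓝 0) := by
    have := ((tendsto_add_atTop_iff_nat 1).2 (hs.tendsto_proj v)).sub (hs.tendsto_proj v)
    rw [sub_self] at this
    exact this.congr fun n => hs.proj_succ_sub n v
  have h2 : Tendsto (fun n => (‖hs.coeff v n • s n‖ / l) ^ p⁻¹) atTop (𝓝 0) := by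
    have := (h1.norm.div_const l).rpow_const (p := p⁻¹) (Or.inr (inv_pos.2 hp.pos).le)
    rwa [norm_zero, zero_div, Real.zero_rpow (inv_pos.2 hp.pos).ne'] at this
  refine squeeze_zero_norm (fun n => ?_) h2
  have h3 : ‖hs.coeff v n‖ ^ p ≤ ‖hs.coeff v n • s n‖ / l := by
    rw [le_div_iff₀ hl, hp.smul]
    exact mul_le_mul_of_nonneg_left (hls n) (by positivity)
  have h4 := Real.rpow_le_rpow (by positivity) h3 (inv_pos.2 hp.pos).le
  rwa [Real.rpow_rpow_inv (norm_nonneg _) hp.pos.ne'] at h4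

variable [ContinuousSMul 𝕜 S] [CompleteSpace S]

/-- A sequence with bounded coefficient functionals dominates every disjoint sequence whose
finite sums are bounded. -/
theorem IsSymmetricSeq.dominates_of_bounded_sums (hp : IsPNorm 𝕜 S p) (hsym : IsSymmetricSeq 𝕜 s)
    {A : ℝ} (hA : 0 < A)
    (hx : ∀ (c : ℕ →₀ 𝕜) (k : ℕ), ‖c k‖ ^ p ≤ A * ‖Finsupp.linearCombination 𝕜 x c‖)
    {z : ℕ → ℕ →₀ 𝕜} (hz : DisjointRows z) {H : ℝ}
    (hH : ∀ F : Finset ℕ, ‖∑ k ∈ F, Finsupp.linearCombination 𝕜 s (z k)‖ ≤ H) :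
    Dominates 𝕜 x (fun k => Finsupp.linearCombination 𝕜 s (z k)) := by
  obtain ⟨C, hC, h⟩ := hsym.exists_domination hp
  refine dominates_of_bound hp (C := C * H * A) fun c => ?_
  have hH0 : 0 ≤ H := (norm_nonneg _).trans (hH ∅)
  rcases eq_or_ne c 0 with rfl | hc
  · simp
  obtain ⟨k₀, hk₀, hmax⟩ := Finset.exists_max_image c.support (fun k => ‖c k‖)
    (Finsupp.support_nonempty_iff.2 hc)
  let F := c.support
  -- Raising all coefficients to the largest one bounds the combination by a multiple of `‖c k₀‖ ^
  -- p`, a sup-norm estimate.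
  let d : ℕ →₀ 𝕜 := Finsupp.indicator F fun _ _ => c k₀
  have hd : ∀ k ∈ F, d k = c k₀ := fun k hk => Finsupp.indicator_of_mem hk _
  have hLd : Finsupp.linearCombination 𝕜 (fun k => Finsupp.linearCombination 𝕜 s (z k)) d =
      c k₀ • ∑ k ∈ F, Finsupp.linearCombination 𝕜 s (z k) := by
    rw [linearCombination_eq_sum _ (Finsupp.support_indicator_subset F _), Finset.smul_sum]
    exact Finset.sum_congr rfl fun k hk => congrArg (· • _) (hd k hk)
  have h1 : ‖Finsupp.linearCombination 𝕜 s (Finsupp.linearCombination 𝕜 z c)‖ ≤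
      C * ‖Finsupp.linearCombination 𝕜 s (Finsupp.linearCombination 𝕜 z d)‖ := by
    refine h _ _ id Function.injective_id.injOn fun j hj => ?_
    obtain ⟨k, hk⟩ := exists_row_of_mem_support hj
    have hkF : k ∈ F := by
      rw [Finsupp.mem_support_iff, hz.apply c hk] at hj
      exact Finsupp.mem_support_iff.2 (left_ne_zero_of_mul hj)
    rw [id, hz.apply c hk, hz.apply d hk, hd k hkF, norm_mul, norm_mul]
    exact mul_le_mul_of_nonneg_right (hmax k hkF) (norm_nonneg _)
  rw [← linearCombination_rows, ← linearCombination_rows, hLd, hp.smul] at h1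
  refine h1.trans ?_
  calc C * (‖c k₀‖ ^ p * ‖∑ k ∈ F, Finsupp.linearCombination 𝕜 s (z k)‖)
      ≤ C * ((A * ‖Finsupp.linearCombination 𝕜 x c‖) * H) :=
        mul_le_mul_of_nonneg_left (mul_le_mul (hx c k₀) (hH F) (norm_nonneg _) (by positivity)) hC.le
    _ = C * H * A * ‖Finsupp.linearCombination 𝕜 x c‖ := by ring

end Generated

/-! ### The limit of the rearranged rows, and the cases where its series diverges -/

section Cases

variable {𝕜 S : Type*} [RCLike 𝕜] [NormedAddCommGroup S] [Module 𝕜 S] [ContinuousSMul 𝕜 S]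
  {p : ℝ} {s B : ℕ → S} (hs : IsSchauderBasis 𝕜 s)

/-- `B` is equivalent to a subsymmetric block basic sequence generated by a vector. -/
def EquivalentToGenerated (B : ℕ → S) : Prop :=
  ∃ (v : S) (y : ℕ → S), IsGeneratedByVector hs v y ∧ IsSubsymmetricSeq 𝕜 y ∧ SeqEquivalent 𝕜 B y

/-- `B` dominates a semi-normalized, uniformly null block basic sequence. -/
def DominatesUniformlyNull (B : ℕ → S) : Prop :=
  ∃ z : ℕ → S, IsBlockBasic hs z ∧ IsSemiNormalized (‖·‖) z ∧ IsUniformlyNull hs z ∧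
    Dominates 𝕜 B z

/-- The rows `u k`, supported in consecutive intervals and spanning a sequence equivalent to `B`,
have rearrangements by `σ k` that are decreasing and converge coordinatewise to `a`. -/
structure IsBlockModel (𝕜 : Type*) [RCLike 𝕜] [Module 𝕜 S] [ContinuousSMul 𝕜 S] (s B : ℕ → S)
    (N : ℕ → ℕ) (u : ℕ → ℕ →₀ 𝕜) (σ : ℕ → Equiv.Perm ℕ) (a : ℕ → 𝕜) : Prop where
  mono : Monotone N
  supp : ∀ k, (u k).support ⊆ Finset.Ico (N k) (N (k + 1))
  equiv : SeqEquivalent 𝕜 B (fun k => Finsupp.linearCombination 𝕜 s (u k))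
  anti : ∀ k, Antitone fun j => ‖u k (σ k j)‖
  lim : ∀ j, Tendsto (fun k => u k (σ k j)) atTop (𝓝 (a j))

variable {N : ℕ → ℕ} {u : ℕ → ℕ →₀ 𝕜} {σ : ℕ → Equiv.Perm ℕ} {a : ℕ → 𝕜}

theorem IsBlockModel.antitone_norm (hm : IsBlockModel 𝕜 s B N u σ a) : Antitone fun j => ‖a j‖ :=
  fun i j hij => le_of_tendsto_of_tendsto' (hm.lim j).norm (hm.lim i).norm fun k => hm.anti k hij

theorem IsBlockModel.disjoint (hm : IsBlockModel 𝕜 s B N u σ a) : DisjointRows u :=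
  disjointRows_of_Ico hm.mono hm.supp

variable [CompleteSpace S]

variable {hs}

theorem EquivalentToGenerated.of_equivalent_basis (hp : IsPNorm 𝕜 S p)
    (hB : IsSubsymmetricSeq 𝕜 B) (h : SeqEquivalent 𝕜 B s) : EquivalentToGenerated hs B := by
  have hcoef : ∀ k, hs.coeff (s k) = Finsupp.single k 1 := fun k => by
    rw [← hs.coeff_linearCombination, Finsupp.linearCombination_single, one_smul]
  -- Every truncation of `s 0` of length at least `1` is `s 0` itself; length `0` would give the
  -- zero vector, hence `k + 1`.
  refine ⟨s 0, s, ⟨⟨hs.ne_zero, fun k i j hi hj => ?_⟩, fun k => k + 1, ?_, fun k => ?_⟩,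
    h.isSubsymmetricSeq hp hB, h⟩
  · rw [hcoef, ← Finsupp.mem_support_iff, Finsupp.mem_support_single] at hi hj
    omega
  · rintro ⟨M, hM⟩
    have := hM ⟨M, rfl⟩
    simp at this
  · have h1 : ∑ j ∈ Finset.range (k + 1), hs.coeff (s 0) j • s j =
        Finsupp.linearCombination 𝕜 s (Finsupp.single 0 1) := by
      rw [linearCombination_eq_sum s (s := Finset.range (k + 1)), hcoef]
      intro i hi
      rw [Finsupp.mem_support_single] at hi
      simp [hi.1]
    have h2 := isRightShift_linearCombination hs (φ := fun j => k + j)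
      (fun i j hij => by simpa using hij) (Finsupp.single 0 1)
    rw [h1]
    simpa using! h2

theorem exists_pos_le_of_antitone {t : ℕ → ℝ} (ht : Antitone t) (h0 : ∀ j, 0 ≤ t j)
    (h : ¬ Tendsto t atTop (𝓝 0)) : ∃ α, 0 < α ∧ ∀ j, α ≤ t j := by
  have hb : BddBelow (Set.range t) := ⟨0, by rintro _ ⟨j, rfl⟩; exact h0 j⟩
  have hlim := tendsto_atTop_ciInf ht hb
  refine ⟨⨅ j, t j, ?_, fun j => ciInf_le hb j⟩
  refine lt_of_le_of_ne (le_ciInf h0) fun h1 => h ?_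
  rwa [← h1] at hlim

/-- Entries of the rows are uniformly bounded, so compactness yields a coordinatewise limit along a
subsequence, and subsymmetry allows passing to it. -/
theorem IsSchauderBasis.exists_blockModel (hs : IsSchauderBasis 𝕜 s) (hp : IsPNorm 𝕜 S p)
    (hsym : IsSymmetricSeq 𝕜 s) (hB : IsSubsymmetricSeq 𝕜 B) :
    ∃ N u σ a, IsBlockModel 𝕜 s B N u σ a := by
  obtain ⟨N, u, hN, hu, heq⟩ := hs.exists_equivalent_block hp hsym hB
  obtain ⟨l, h, hl, hlh⟩ := (heq.isSubsymmetricSeq hp hB).exists_norm_bounds hp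
  obtain ⟨l', h', hl', hlh'⟩ := (hsym.exists_uniform_bound hp).1
  obtain ⟨A, hA, hcoef⟩ := hs.exists_coeff_bound hp hl' fun k => (hlh' k).1
  choose σ hσ using fun k => exists_perm_antitone (u k)
  obtain ⟨a, φ, hφ, ha⟩ := exists_subseq_tendsto (a := fun k j => u k (σ k j))
    (M := (A * h) ^ p⁻¹) fun k j => by
      have h1 := (hcoef _ (σ k j)).trans (mul_le_mul_of_nonneg_left (hlh k).2 hA.le)
      rw [hs.coeff_linearCombination] at h1
      have h2 := Real.rpow_le_rpow (by positivity) h1 (inv_pos.2 hp.pos).le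
      rwa [Real.rpow_rpow_inv (norm_nonneg _) hp.pos.ne'] at h2
  refine ⟨N ∘ φ, u ∘ φ, σ ∘ φ, a, hN.monotone.comp hφ.monotone, fun k => ?_, ?_, fun k => hσ _, ha⟩
  · refine (hu (φ k)).trans (Finset.Ico_subset_Ico le_rfl (hN.monotone ?_))
    exact hφ k.lt_succ_self
  · exact (hB.2 φ hφ).symm.trans (heq.comp hp φ)

namespace IsBlockModel

/-- Such a sum is a limit of pieces of rearranged rows, and these are dominated by the bounded rows.
-/
theorem exists_sum_bound (hm : IsBlockModel 𝕜 s B N u σ a) (hp : IsPNorm 𝕜 S p)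
    (hsym : IsSymmetricSeq 𝕜 s) (hB : IsSubsymmetricSeq 𝕜 B) :
    ∃ H, ∀ F : Finset ℕ, ‖∑ j ∈ F, a j • s j‖ ≤ H := by
  obtain ⟨C, hC, hdom⟩ := hsym.exists_domination hp
  obtain ⟨l, h, hl, hlh⟩ := (hm.equiv.isSubsymmetricSeq hp hB).exists_norm_bounds hp
  refine ⟨C * h, fun F => ?_⟩
  have hlim : Tendsto (fun k => ∑ j ∈ F, u k (σ k j) • s j) atTop (𝓝 (∑ j ∈ F, a j • s j)) :=
    tendsto_finsetSum _ fun j _ => (hm.lim j).smul_const _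
  refine le_of_tendsto' hlim.norm fun k => ?_
  have h1 := hdom (Finsupp.indicator F fun j _ => u k (σ k j)) (u k) (σ k)
    (σ k).injective.injOn fun j hj => by
      rw [Finsupp.indicator_of_mem (Finsupp.support_indicator_subset F _ hj)]
  rw [linearCombination_eq_sum s (Finsupp.support_indicator_subset F _),
    Finset.sum_congr rfl fun j hj => by rw [Finsupp.indicator_of_mem hj]] at h1
  exact h1.trans (mul_le_mul_of_nonneg_left (hlh k).2 hC.le)

/-- Failure of the Cauchy criterion supplies disjoint chunks of the series with norm at least `δ`.
Their finite sums are finite sums of the series, hence bounded, so `B` dominates them. -/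
theorem dominates_of_divergent (hm : IsBlockModel 𝕜 s B N u σ a) (hp : IsPNorm 𝕜 S p)
    (hsym : IsSymmetricSeq 𝕜 s) (hB : IsSubsymmetricSeq 𝕜 B) (ha : Tendsto a atTop (𝓝 0))
    (hdiv : ¬ ∃ v, SeriesTendsto 𝕜 s a v) : DominatesUniformlyNull hs B := by
  obtain ⟨H, hH⟩ := hm.exists_sum_bound hp hsym hB
  obtain ⟨l, h, hl, hlh⟩ := hB.exists_norm_bounds hp
  obtain ⟨A, hA, hcoef⟩ := hB.1.1.exists_coeff_bound hp hl fun k => (hlh k).1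
  have hnc : ∃ δ > 0, ∀ n₀, ∃ m n, n₀ ≤ m ∧ m < n ∧ δ ≤ ‖∑ j ∈ Finset.Ico m n, a j • s j‖ := by
    by_contra! hcon
    refine hdiv (cauchySeq_tendsto_of_complete (Metric.cauchySeq_iff'.2 fun ε hε => ?_))
    obtain ⟨n₀, hn₀⟩ := hcon ε hε
    refine ⟨n₀, fun n hn => ?_⟩
    rcases hn.eq_or_lt with rfl | hn
    · simpa using hε
    · rw [dist_eq_norm, ← Finset.sum_Ico_eq_sub _ hn.le]
      exact hn₀ n₀ n le_rfl hn
  obtain ⟨δ, hδ, hmn⟩ := hnc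
  choose m n hm0 hmn' hδmn using hmn
  let M : ℕ → ℕ := fun k => Nat.rec 0 (fun _ z => n z) k
  have hM : StrictMono M := strictMono_nat_of_lt_succ fun k => (hm0 (M k)).trans_lt (hmn' (M k))
  let z : ℕ → ℕ →₀ 𝕜 := fun k => Finsupp.indicator (Finset.Ico (m (M k)) (n (M k))) fun j _ => a j
  have hz0 : ∀ k, (z k).support ⊆ Finset.Ico (m (M k)) (n (M k)) := fun k =>
    Finsupp.support_indicator_subset _ _
  have hz : ∀ k, (z k).support ⊆ Finset.Ico (M k) (M (k + 1)) := fun k =>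
    (hz0 k).trans (Finset.Ico_subset_Ico (hm0 _) le_rfl)
  have hL : ∀ k, Finsupp.linearCombination 𝕜 s (z k) =
      ∑ j ∈ Finset.Ico (m (M k)) (n (M k)), a j • s j := fun k => by
    rw [linearCombination_eq_sum s (hz0 k)]
    exact Finset.sum_congr rfl fun j hj => congrArg (· • _) (Finsupp.indicator_of_mem hj _)
  have hdisj := disjointRows_of_Ico hM.monotone hz
  refine ⟨fun k => Finsupp.linearCombination 𝕜 s (z k), isBlockBasic_of_Ico hs hz fun k h0 => ?_,
    ⟨δ, H, hδ, fun k => ?_⟩, isUniformlyNull_of_le hs (t := fun k => ‖a (M k)‖) ?_ fun k j => ?_,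
    hsym.dominates_of_bounded_sums hp hA hcoef hdisj (H := H) fun F => ?_⟩
  · have := hδmn (M k)
    rw [← hL, h0, norm_zero] at this
    linarith
  · simp only [hL]
    exact ⟨hδmn _, hH _⟩
  · simpa using (ha.comp hM.tendsto_atTop).norm
  · rw [hs.coeff_linearCombination]
    by_cases hj : j ∈ (z k).support
    · rw [show z k j = a j from Finsupp.indicator_of_mem (hz0 k hj) _]
      exact hm.antitone_norm (Finset.mem_Ico.1 (hz k hj)).1
    · rw [Finsupp.notMem_support_iff.1 hj, norm_zero]
      exact norm_nonneg _
  · simp only [hL]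
    rw [← Finset.sum_biUnion]
    · exact hH _
    · intro i _ j _ hij
      rw [Function.onFun, Finset.disjoint_left]
      intro t hti htj
      have h1 := Finset.mem_Ico.1 hti
      have h2 := Finset.mem_Ico.1 htj
      have h3 := hm0 (M i)
      have h4 := hm0 (M j)
      rcases lt_or_gt_of_ne hij with h | h
      · have : n (M i) ≤ M j := hM.monotone (Nat.succ_le_of_lt h)
        omega
      · have : n (M j) ≤ M i := hM.monotone (Nat.succ_le_of_lt h)
        omega

/-- The moduli `‖a j‖` decrease, so they are bounded below by some `α > 0`. Both `s` and the rows
then have bounded finite sums, and each is dominated by the other. -/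
theorem generated_of_not_tendsto_zero (hm : IsBlockModel 𝕜 s B N u σ a) (hp : IsPNorm 𝕜 S p)
    (hsym : IsSymmetricSeq 𝕜 s) (hB : IsSubsymmetricSeq 𝕜 B) (ha : ¬ Tendsto a atTop (𝓝 0)) :
    EquivalentToGenerated hs B := by
  obtain ⟨H, hH⟩ := hm.exists_sum_bound hp hsym hB
  obtain ⟨l, h, hl, hlh⟩ := hB.exists_norm_bounds hp
  obtain ⟨A, hA, hcoef⟩ := hB.1.1.exists_coeff_bound hp hl fun k => (hlh k).1
  obtain ⟨l', h', hl', hlh'⟩ := (hsym.exists_uniform_bound hp).1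
  obtain ⟨A', hA', hcoef'⟩ := hsym.1.exists_coeff_bound hp hl' fun k => (hlh' k).1
  obtain ⟨C, hC, hdom⟩ := hsym.exists_domination hp
  obtain ⟨ly, hy, hly, hlhy⟩ := (hm.equiv.isSubsymmetricSeq hp hB).exists_norm_bounds hp
  obtain ⟨α, hα, haα⟩ := exists_pos_le_of_antitone hm.antitone_norm (fun j => norm_nonneg _)
    fun h0 => ha (tendsto_zero_iff_norm_tendsto_zero.2 h0)
  -- Entries of modulus at most `‖c‖` lie below those of `(c / α) * a`, whose finite sums are
  -- bounded.
  have hone : ∀ (c : 𝕜) (d : ℕ →₀ 𝕜) (G : Finset ℕ), d.support ⊆ G → (∀ j, ‖d j‖ ≤ ‖c‖) →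
      ‖Finsupp.linearCombination 𝕜 s d‖ ≤ C * (‖c / (α : 𝕜)‖ ^ p * H) := by
    intro c d G hdG hd
    have h1 := hdom d (Finsupp.indicator G fun j _ => c / (α : 𝕜) * a j) id
      Function.injective_id.injOn fun j hj => by
        rw [id, Finsupp.indicator_of_mem (hdG hj), norm_mul, norm_div, RCLike.norm_ofReal,
          abs_of_pos hα, div_mul_eq_mul_div, le_div_iff₀ hα]
        exact mul_le_mul (hd j) (haα j) hα.le (norm_nonneg _)
    rw [linearCombination_eq_sum s (c := Finsupp.indicator G _) (Finsupp.support_indicator_subset G _),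
      Finset.sum_congr rfl fun j hj => by rw [Finsupp.indicator_of_mem hj, mul_smul],
      ← Finset.smul_sum, hp.smul] at h1
    exact h1.trans (mul_le_mul_of_nonneg_left (mul_le_mul_of_nonneg_left (hH G) (by positivity))
      hC.le)
  refine .of_equivalent_basis hp hB ⟨?_, ?_⟩
  · have h1 := hsym.dominates_of_bounded_sums hp hA hcoef (z := fun k => Finsupp.single k 1)
      (fun k l j hk hl => by
        rw [Finsupp.mem_support_single] at hk hl
        exact hk.1.symm.trans hl.1) (H := C * (‖1 / (α : 𝕜)‖ ^ p * H)) fun F => by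
      rw [← map_sum]
      refine hone 1 _ F ?_ fun j => ?_
      · intro j hj
        by_contra hjF
        refine Finsupp.mem_support_iff.1 hj ?_
        rw [Finsupp.finsetSum_apply]
        exact Finset.sum_eq_zero fun k hk => Finsupp.single_eq_of_ne (by rintro rfl; exact hjF hk)
      · rw [Finsupp.finsetSum_apply]
        simp only [Finsupp.single_apply, Finset.sum_ite_eq']
        split_ifs <;> simp
    simpa using h1
  · refine Dominates.trans ?_ hm.equiv.2
    set M := (A' * hy) ^ p⁻¹ with hM
    have hy0 : 0 < hy := hly.trans_le ((hlhy 0).1.trans (hlhy 0).2)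
    have hM0 : 0 ≤ M := by positivity
    have hub : ∀ k j, ‖u k j‖ ≤ M := fun k j => by
      have h1 := (hcoef' (u k) j).trans (mul_le_mul_of_nonneg_left (hlhy k).2 hA'.le)
      have h2 := Real.rpow_le_rpow (by positivity) h1 (inv_pos.2 hp.pos).le
      rwa [Real.rpow_rpow_inv (norm_nonneg _) hp.pos.ne'] at h2
    refine hsym.dominates_of_bounded_sums hp hA' hcoef' hm.disjoint
      (H := C * (‖(M : 𝕜) / (α : 𝕜)‖ ^ p * H)) fun F => ?_
    rw [← map_sum]
    refine hone M _ _ subset_rfl fun j => ?_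
    rw [RCLike.norm_ofReal, abs_of_nonneg hM0, Finsupp.finsetSum_apply]
    by_cases hj : ∃ k ∈ F, u k j ≠ 0
    · obtain ⟨k, hk, hkj⟩ := hj
      rw [Finset.sum_eq_single_of_mem k hk]
      · exact hub k j
      · intro i _ hik
        by_contra h0
        exact hik (hm.disjoint i k j (Finsupp.mem_support_iff.2 h0) (Finsupp.mem_support_iff.2 hkj))
    · push Not at hj
      rw [Finset.sum_eq_zero hj, norm_zero]
      exact hM0

end IsBlockModel

end Cases

/-! ### The case of a convergent series, and the dichotomy -/

section Convergent

variable {𝕜 S : Type*} [RCLike 𝕜] [NormedAddCommGroup S] [Module 𝕜 S] [ContinuousSMul 𝕜 S]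
  [CompleteSpace S] {p : ℝ} {s B : ℕ → S} {hs : IsSchauderBasis 𝕜 s}

/-- Where disjoint rows are placed does not matter: undoing `f k` and applying `g k` is an injection
between rows that preserves entries. Exchanging `f` and `g` gives equivalence. -/
theorem IsSymmetricSeq.exists_mapDomain_bound (hp : IsPNorm 𝕜 S p) (hsym : IsSymmetricSeq 𝕜 s) :
    ∃ C, 0 < C ∧ ∀ (t : ℕ → ℕ →₀ 𝕜) (f g : ℕ → ℕ → ℕ), (∀ k, Function.Injective (f k)) →
      (∀ k, Function.Injective (g k)) → DisjointRows (fun k => (t k).mapDomain (f k)) →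
      DisjointRows (fun k => (t k).mapDomain (g k)) → ∀ c : ℕ →₀ 𝕜,
      ‖Finsupp.linearCombination 𝕜
        (fun k => Finsupp.linearCombination 𝕜 s ((t k).mapDomain (f k))) c‖ ≤
      C * ‖Finsupp.linearCombination 𝕜
        (fun k => Finsupp.linearCombination 𝕜 s ((t k).mapDomain (g k))) c‖ := by
  classical
  obtain ⟨C, hC, h⟩ := hsym.exists_rows_bound hp
  refine ⟨C, hC, fun t f g hf hg hft hgt c => ?_⟩
  have hinv : ∀ k, ∀ i ∈ ((t k).mapDomain (f k)).support, ∃ j, f k j = i := fun k i hi => by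
    obtain ⟨j, -, hj⟩ := Finset.mem_image.1 (Finsupp.mapDomain_support hi)
    exact ⟨j, hj⟩
  refine h _ _ (fun k i => g k (Function.invFun (f k) i)) hft hgt (fun k i hi j hj hij => ?_)
    (fun k i hi => ?_) c
  · obtain ⟨i', rfl⟩ := hinv k i hi
    obtain ⟨j', rfl⟩ := hinv k j hj
    have := hg k hij
    rw [Function.leftInverse_invFun (hf k), Function.leftInverse_invFun (hf k)] at this
    rw [this]
  · obtain ⟨i', rfl⟩ := hinv k i hi
    rw [Function.leftInverse_invFun (hf k), Finsupp.mapDomain_apply (hf k),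
      Finsupp.mapDomain_apply (hg k)]

theorem disjointRows_pair (t : ℕ → ℕ →₀ 𝕜) {f : ℕ → ℕ} (hf : Function.Injective f) :
    DisjointRows fun k => (t k).mapDomain (Nat.pair (f k)) := by
  classical
  intro k l j hk hl
  obtain ⟨i, -, hi⟩ := Finset.mem_image.1 (Finsupp.mapDomain_support hk)
  obtain ⟨i', -, hi'⟩ := Finset.mem_image.1 (Finsupp.mapDomain_support hl)
  exact hf (Nat.pair_eq_pair.1 (hi.trans hi'.symm)).1

theorem pair_injective (k : ℕ) : Function.Injective (Nat.pair k) :=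
  fun _ _ h => (Nat.pair_eq_pair.1 h).2

variable {N : ℕ → ℕ} {u : ℕ → ℕ →₀ 𝕜} {σ : ℕ → Equiv.Perm ℕ} {a : ℕ → 𝕜}

namespace IsBlockModel

/-- Put the rearranged rows `w m` and the nearby truncations `T m` into the same consecutive
intervals. The former span a sequence equivalent to a subsequence of the rows, the latter are
generated by `v`, and the two are small perturbations of each other. -/
theorem generated_of_frequently (hm : IsBlockModel 𝕜 s B N u σ a) (hp : IsPNorm 𝕜 S p)
    (hsym : IsSymmetricSeq 𝕜 s) (hB : IsSubsymmetricSeq 𝕜 B) {v : S}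
    (hfreq : ∀ ε : ℝ, 0 < ε → ∀ n₀, ∃ᶠ k in atTop, ∃ n, n₀ ≤ n ∧ ‖Finsupp.linearCombination 𝕜 s
      ((u k).mapDomain (σ k).symm - hs.truncate 0 n v)‖ ≤ ε) : EquivalentToGenerated hs B := by
  obtain ⟨C, hC, hbound⟩ := hsym.exists_mapDomain_bound hp
  obtain ⟨D, hD, hunif⟩ := (hsym.exists_uniform_bound hp).2
  have hy := hm.equiv.isSubsymmetricSeq hp hB
  obtain ⟨l, h, hl, hlh⟩ := hy.exists_norm_bounds hp
  obtain ⟨A, hA, hcoef⟩ := hy.1.1.exists_coeff_bound hp hl fun k => (hlh k).1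
  have hA' : 0 < A * C := by positivity
  obtain ⟨ψ, hψ, hψn⟩ := extraction_forall_of_frequently fun m =>
    -- `A * C` bounds the coefficients with respect to `X`, and `D` pays for the shift into place;
    -- the minimal length `m + 1` makes the lengths unbounded.
    hfreq (1 / (4 * (A * C)) * (1 / 2) ^ m / D) (by positivity) (m + 1)
  choose n hmn hn using hψn
  let w : ℕ → ℕ →₀ 𝕜 := fun m => (u (ψ m)).mapDomain (σ (ψ m)).symm
  let T : ℕ → ℕ →₀ 𝕜 := fun m => hs.truncate 0 (n m) v
  have hwu : ∀ m, (w m).mapDomain (σ (ψ m)) = u (ψ m) := fun m => by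
    rw [← Finsupp.mapDomain_comp, Equiv.self_comp_symm, Finsupp.mapDomain_id]
  obtain ⟨M, hM, hMs⟩ := exists_placement (v := w) (w := T)
  have hdu : DisjointRows fun m => (w m).mapDomain (σ (ψ m)) := by
    simp only [hwu]
    exact hm.disjoint.comp hψ.injective
  have hdw : DisjointRows fun m => (w m).mapDomain (M m + ·) :=
    disjointRows_of_Ico hM fun k => (hMs k).1
  let X : ℕ → S := fun m => Finsupp.linearCombination 𝕜 s ((w m).mapDomain (M m + ·))
  let Y : ℕ → S := fun m => Finsupp.linearCombination 𝕜 s ((T m).mapDomain (M m + ·))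
  have hyX : ∀ c : ℕ →₀ 𝕜, ‖Finsupp.linearCombination 𝕜
      ((fun k => Finsupp.linearCombination 𝕜 s (u k)) ∘ ψ) c‖ ≤
        C * ‖Finsupp.linearCombination 𝕜 X c‖ := fun c => by
    have := hbound w (fun m => σ (ψ m)) (fun m => (M m + ·)) (fun m => (σ (ψ m)).injective)
      (fun m => add_right_injective _) hdu hdw c
    simp only [hwu] at this
    exact this
  have hXy : ∀ c : ℕ →₀ 𝕜, ‖Finsupp.linearCombination 𝕜 X c‖ ≤ C * ‖Finsupp.linearCombination 𝕜
      ((fun k => Finsupp.linearCombination 𝕜 s (u k)) ∘ ψ) c‖ := fun c => by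
    have := hbound w (fun m => (M m + ·)) (fun m => σ (ψ m)) (fun m => add_right_injective _)
      (fun m => (σ (ψ m)).injective) hdw hdu c
    simp only [hwu] at this
    exact this
  have hXY : SeqEquivalent 𝕜 X Y := by
    refine seqEquivalent_of_perturbation hp hA' (fun c k => ?_) fun m => ?_
    · have h1 := hcoef (c.mapDomain ψ) (ψ k)
      rw [Finsupp.mapDomain_apply hψ.injective, Finsupp.linearCombination_mapDomain] at h1
      rw [mul_assoc]
      exact h1.trans (mul_le_mul_of_nonneg_left (hyX c) hA.le)
    · have h1 : X m - Y m = Finsupp.linearCombination 𝕜 (s ∘ (M m + ·)) (w m - T m) := by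
        rw [map_sub, ← Finsupp.linearCombination_mapDomain, ← Finsupp.linearCombination_mapDomain]
      rw [h1]
      refine (hunif _ _ (add_right_injective _).injOn).trans ?_
      have h2 := hn m
      rw [le_div_iff₀ hD] at h2
      rwa [mul_comm]
  have hBY : SeqEquivalent 𝕜 B Y := by
    refine ((hB.2 ψ hψ).symm.trans (hm.equiv.comp hp ψ)).trans (SeqEquivalent.trans ?_ hXY)
    exact ⟨dominates_of_bound hp hXy, dominates_of_bound hp hyX⟩
  have hYs := hBY.isSubsymmetricSeq hp hB
  refine ⟨v, Y, ⟨isBlockBasic_of_Ico hs (fun k => (hMs k).2) hYs.1.1.ne_zero, n, ?_, fun k => ?_⟩,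
    hYs, hBY⟩
  · rintro ⟨b, hb⟩
    have h1 := hb ⟨b, rfl⟩
    have h2 := hmn b
    omega
  · rw [← hs.linearCombination_truncate_zero]
    have := isRightShift_linearCombination hs (φ := (M k + ·)) (fun i j hij => by simpa using hij)
      (T k)
    rwa [← Finsupp.linearCombination_mapDomain] at this

/-- For fixed `m`, the first `n₀ + m` rearranged entries of a late row nearly agree with those of
`v`, so the distance `ε` must come from the remaining entries. These have norm at least `ε / 2`, and
monotonicity bounds each by about `‖a (n₀ + m)‖`. -/
theorem dominates_of_not_frequently (hm : IsBlockModel 𝕜 s B N u σ a) (hp : IsPNorm 𝕜 S p)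
    (hsym : IsSymmetricSeq 𝕜 s) (hB : IsSubsymmetricSeq 𝕜 B) {v : S} (hv : hs.coeff v = a)
    {ε : ℝ} (hε : 0 < ε) {n₀ : ℕ} (hev : ∀ᶠ k in atTop, ∀ n, n₀ ≤ n →
      ε < ‖Finsupp.linearCombination 𝕜 s ((u k).mapDomain (σ k).symm - hs.truncate 0 n v)‖) :
    DominatesUniformlyNull hs B := by
  classical
  obtain ⟨C, hC, hdom⟩ := hsym.exists_domination hp
  obtain ⟨R, hR, hrows⟩ := hsym.exists_rows_bound hp
  obtain ⟨l', h', hl', hlh'⟩ := (hsym.exists_uniform_bound hp).1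
  have hy := hm.equiv.isSubsymmetricSeq hp hB
  obtain ⟨l, h, hl, hlh⟩ := hy.exists_norm_bounds hp
  have ha : Tendsto a atTop (𝓝 0) := hv ▸ hs.tendsto_coeff_zero hp hl' (fun k => (hlh' k).1) v
  have hwapp : ∀ k j, (u k).mapDomain (σ k).symm j = u k (σ k j) := fun k j => by
    rw [← Finsupp.equivMapDomain_eq_mapDomain, Finsupp.equivMapDomain_apply, Equiv.symm_symm]
  have hstep : ∀ m : ℕ, ∀ᶠ k in atTop, ‖u k (σ k (n₀ + m))‖ ≤ ‖a (n₀ + m)‖ + 1 / ((m : ℝ) + 1) ∧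
      ε / 2 ≤ ‖Finsupp.linearCombination 𝕜 s
        (((u k).mapDomain (σ k).symm).filter fun j => ¬ j < n₀ + m)‖ := by
    intro m
    have h1 : ∀ᶠ k in atTop, ‖u k (σ k (n₀ + m))‖ < ‖a (n₀ + m)‖ + 1 / ((m : ℝ) + 1) :=
      (hm.lim (n₀ + m)).norm.eventually_lt_const (lt_add_of_pos_right _ (by positivity))
    have h2 : Tendsto (fun k => ‖∑ j ∈ Finset.range (n₀ + m), (u k (σ k j) - a j) • s j‖) atTop
        (𝓝 0) := by
      have := tendsto_finsetSum (Finset.range (n₀ + m)) fun j _ =>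
        ((hm.lim j).sub_const (a j)).smul_const (s j)
      simpa using this.norm
    filter_upwards [h1, h2.eventually_le_const (half_pos hε), hev] with k hk1 hk2 hk3
    refine ⟨hk1.le, ?_⟩
    have h3 := hk3 (n₀ + m) (Nat.le_add_right _ _)
    have h4 : Finsupp.linearCombination 𝕜 s
        ((u k).mapDomain (σ k).symm - hs.truncate 0 (n₀ + m) v) =
        ∑ j ∈ Finset.range (n₀ + m), (u k (σ k j) - a j) • s j +
        Finsupp.linearCombination 𝕜 s
          (((u k).mapDomain (σ k).symm).filter fun j => ¬ j < n₀ + m) := by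
      rw [map_sub, linearCombination_filter_add s _ (· < n₀ + m), linearCombination_filter_lt,
        hs.linearCombination_truncate_zero]
      simp only [hwapp, sub_smul, Finset.sum_sub_distrib, hv]
      abel
    rw [h4] at h3
    linarith [norm_add_le (∑ j ∈ Finset.range (n₀ + m), (u k (σ k j) - a j) • s j)
      (Finsupp.linearCombination 𝕜 s
        (((u k).mapDomain (σ k).symm).filter fun j => ¬ j < n₀ + m))]
  obtain ⟨ψ, hψ, hψs⟩ := extraction_forall_of_eventually hstep
  -- The entries of rank at least `n₀ + m`, left in their original positions so that the block
  -- structure persists.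
  let z : ℕ → ℕ →₀ 𝕜 := fun m => (u (ψ m)).filter fun i => n₀ + m ≤ (σ (ψ m)).symm i
  have hzu : ∀ m, (z m).support ⊆ (u (ψ m)).support := fun m => by
    simp only [z, Finsupp.support_filter]
    exact Finset.filter_subset _ _
  have hzapp : ∀ m, ∀ i ∈ (z m).support, n₀ + m ≤ (σ (ψ m)).symm i ∧ z m i = u (ψ m) i :=
    fun m i hi => by
      simp only [z, Finsupp.support_filter, Finset.mem_filter] at hi
      exact ⟨hi.2, Finsupp.filter_apply_pos _ _ hi.2⟩
  have hz : ∀ m, (z m).support ⊆ Finset.Ico (N (ψ m)) (N (ψ (m + 1))) := fun m =>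
    ((hzu m).trans (hm.supp (ψ m))).trans
      (Finset.Ico_subset_Ico le_rfl (hm.mono (hψ m.lt_succ_self)))
  have hlow : ∀ m, ε / (2 * C) ≤ ‖Finsupp.linearCombination 𝕜 s (z m)‖ := fun m => by
    have h1 := hdom (((u (ψ m)).mapDomain (σ (ψ m)).symm).filter fun j => ¬ j < n₀ + m) (z m)
      (σ (ψ m)) (σ (ψ m)).injective.injOn fun j hj => by
        rw [Finsupp.support_filter, Finset.mem_filter] at hj
        simp only [z]
        rw [Finsupp.filter_apply_pos (fun j => ¬ j < n₀ + m) _ hj.2, hwapp,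
          Finsupp.filter_apply_pos]
        rw [Equiv.symm_apply_apply]
        exact not_lt.1 hj.2
    rw [div_le_iff₀ (by positivity)]
    linarith [(hψs m).2]
  have hpos : 0 < ε / (2 * C) := by positivity
  refine ⟨fun m => Finsupp.linearCombination 𝕜 s (z m),
    isBlockBasic_of_Ico hs (N := fun m => N (ψ m)) hz fun m h0 => ?_,
    ⟨ε / (2 * C), C * h, hpos, fun m => ⟨hlow m, ?_⟩⟩,
    isUniformlyNull_of_le hs (t := fun m : ℕ => ‖a (n₀ + m)‖ + 1 / ((m : ℝ) + 1)) ?_ fun m i => ?_,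
    ((hm.equiv.comp hp ψ).symm.trans (hB.2 ψ hψ)).2.trans (dominates_of_bound hp (C := R) fun c => ?_)⟩
  · have := hlow m
    rw [h0, norm_zero] at this
    linarith
  · refine (hdom (z m) (u (ψ m)) id Function.injective_id.injOn fun i hi => ?_).trans
      (mul_le_mul_of_nonneg_left (hlh _).2 hC.le)
    rw [(hzapp m i hi).2, id]
  · have h1 : Tendsto (fun m => a (n₀ + m)) atTop (𝓝 0) := by
      have := (tendsto_add_atTop_iff_nat n₀).2 ha
      simpa [add_comm] using this
    simpa using h1.norm.add tendsto_one_div_add_atTop_nhds_zero_nat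
  · rw [hs.coeff_linearCombination]
    by_cases hi : i ∈ (z m).support
    · rw [(hzapp m i hi).2]
      have := hm.anti (ψ m) (hzapp m i hi).1
      simp only [Equiv.apply_symm_apply] at this
      exact this.trans (hψs m).1
    · rw [Finsupp.notMem_support_iff.1 hi, norm_zero]
      positivity
  · refine hrows z (u ∘ ψ) (fun _ => id) (fun k l j hk hl => ?_) (hm.disjoint.comp hψ.injective)
      (fun _ => Function.injective_id.injOn) (fun m i hi => ?_) c
    · exact hψ.injective (hm.disjoint _ _ j (hzu k hk) (hzu l hl))
    · rw [(hzapp m i hi).2]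
      rfl

end IsBlockModel

theorem IsSchauderBasis.generated_or_dominates (hs : IsSchauderBasis 𝕜 s) (hp : IsPNorm 𝕜 S p)
    (hsym : IsSymmetricSeq 𝕜 s) (hB : IsSubsymmetricSeq 𝕜 B) :
    EquivalentToGenerated hs B ∨
      ((∃ y, IsBlockBasic hs y ∧ SeqEquivalent 𝕜 B y) ∧ DominatesUniformlyNull hs B) := by
  obtain ⟨N, u, σ, a, hm⟩ := hs.exists_blockModel hp hsym hB
  have hblock : ∃ y, IsBlockBasic hs y ∧ SeqEquivalent 𝕜 B y :=
    ⟨_, isBlockBasic_of_Ico hs hm.supp (hm.equiv.isBasicSeq hB.1.1).ne_zero, hm.equiv⟩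
  by_cases hconv : ∃ v, SeriesTendsto 𝕜 s a v
  · obtain ⟨v, hv⟩ := hconv
    by_cases hfreq : ∀ ε : ℝ, 0 < ε → ∀ n₀, ∃ᶠ k in atTop, ∃ n, n₀ ≤ n ∧
      ‖Finsupp.linearCombination 𝕜 s ((u k).mapDomain (σ k).symm - hs.truncate 0 n v)‖ ≤ ε
    · exact .inl (hm.generated_of_frequently hp hsym hB hfreq)
    · push Not at hfreq
      obtain ⟨ε, hε, n₀, hev⟩ := hfreq
      exact .inr ⟨hblock, hm.dominates_of_not_frequently hp hsym hB (hs.eq_coeff hv).symm hε hev⟩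
  · by_cases ha : Tendsto a atTop (𝓝 0)
    · exact .inr ⟨hblock, hm.dominates_of_divergent hp hsym hB ha hconv⟩
    · exact .inl (hm.generated_of_not_tendsto_zero hp hsym hB ha)

end Convergent

/-! ### Sequences generated by a vector are symmetric -/

section Symmetric

variable {𝕜 S : Type*} [RCLike 𝕜] [NormedAddCommGroup S] [Module 𝕜 S]
  {p : ℝ} {s B : ℕ → S} {hs : IsSchauderBasis 𝕜 s}

/-- Only neighbouring blocks are compared by definition; the chain goes through because intermediate
blocks, being non-zero, have non-empty support. -/
theorem IsBlockBasic.lt_of_lt {y : ℕ → S} (hy : IsBlockBasic hs y) {k l : ℕ} (hkl : k < l) {i j : ℕ}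
    (hi : hs.coeff (y k) i ≠ 0) (hj : hs.coeff (y l) j ≠ 0) : i < j := by
  induction l, hkl using Nat.le_induction generalizing j with
  | base => exact hy.2 k i j hi hj
  | succ l _ ih =>
    have hex : ∃ t, hs.coeff (y l) t ≠ 0 := by
      by_contra! h0
      refine hy.1 l (tendsto_nhds_unique (hs.coeff_spec (y l)) ?_)
      refine tendsto_const_nhds.congr fun n => ?_
      simp [h0]
    obtain ⟨t, ht⟩ := hex
    exact (ih ht).trans (hy.2 l t j ht hj)

variable [ContinuousSMul 𝕜 S]

theorem IsSchauderBasis.mem_closedSpan (hs : IsSchauderBasis 𝕜 s) (v : S) : v ∈ closedSpan 𝕜 s := by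
  refine (Submodule.isClosed_topologicalClosure _).mem_of_tendsto (hs.tendsto_proj v)
    (Eventually.of_forall fun n => ?_)
  rw [IsSchauderBasis.proj, ← hs.linearCombination_truncate_zero]
  exact linearCombination_mem_closedSpan s _

variable [CompleteSpace S]

/-- A vector whose copies along the rows of a partition of `ℕ` are shifted by `f` spans
a symmetric sequence. -/
theorem IsSchauderBasis.exists_copies (hs : IsSchauderBasis 𝕜 s) (hp : IsPNorm 𝕜 S p)
    (hsym : IsSymmetricSeq 𝕜 s) (v : S) : ∃ (W : ℕ → S) (C : ℝ), 0 < C ∧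
      (∀ i n, ‖Finsupp.linearCombination 𝕜 s ((hs.truncate 0 n v).mapDomain (Nat.pair i)) - W i‖ ≤
        C * ‖hs.proj n v - v‖) ∧ ∀ π : Equiv.Perm ℕ, SeqEquivalent 𝕜 (W ∘ π) W := by
  obtain ⟨C, hC, hunif⟩ := (hsym.exists_uniform_bound hp).2
  obtain ⟨D, hD, hmap⟩ := hsym.exists_mapDomain_bound hp
  -- `T i` moves `S` into the `i`-th row of a partition of the basis, with a norm bound independent
  -- of `i`.
  choose T hT hTC using fun i => exists_extension (x := s) (y := s ∘ Nat.pair i) (C := C)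
    fun c => hunif c (Nat.pair i) (pair_injective i).injOn
  have hTL : ∀ i (c : ℕ →₀ 𝕜), T i ⟨_, linearCombination_mem_closedSpan s c⟩ =
      Finsupp.linearCombination 𝕜 s (c.mapDomain (Nat.pair i)) := fun i c => by
    rw [← linearCombination_closedSpan, ← ContinuousLinearMap.coe_coe,
      Finsupp.apply_linearCombination 𝕜 (T i).toLinearMap, Finsupp.linearCombination_mapDomain]
    congr 2
    exact funext (hT i)
  let W : ℕ → S := fun i => T i ⟨v, hs.mem_closedSpan v⟩
  have hW : ∀ i n, ‖Finsupp.linearCombination 𝕜 s ((hs.truncate 0 n v).mapDomain (Nat.pair i)) -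
      W i‖ ≤ C * ‖hs.proj n v - v‖ := fun i n => by
    rw [← hTL, ← map_sub]
    refine (hTC i _).trans_eq ?_
    rw [Submodule.coe_norm, Submodule.coe_sub]
    simp only [hs.linearCombination_truncate_zero, IsSchauderBasis.proj]
  have hWlim : ∀ i, Tendsto (fun n => Finsupp.linearCombination 𝕜 s
      ((hs.truncate 0 n v).mapDomain (Nat.pair i))) atTop (𝓝 (W i)) := fun i => by
    rw [tendsto_iff_norm_sub_tendsto_zero]
    refine squeeze_zero (fun _ => norm_nonneg _) (hW i) ?_
    have := (tendsto_iff_norm_sub_tendsto_zero.1 (hs.tendsto_proj v)).const_mul C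
    rwa [mul_zero] at this
  have hWc : ∀ (f : ℕ → ℕ) (c : ℕ →₀ 𝕜), Tendsto (fun n => Finsupp.linearCombination 𝕜 (fun k =>
      Finsupp.linearCombination 𝕜 s ((hs.truncate 0 n v).mapDomain (Nat.pair (f k)))) c) atTop
      (𝓝 (Finsupp.linearCombination 𝕜 (W ∘ f) c)) := fun f c => by
    simp only [Finsupp.linearCombination_apply, Finsupp.sum]
    exact tendsto_finsetSum _ fun k _ => (hWlim (f k)).const_smul (c k)
  have hWb : ∀ f g : ℕ → ℕ, Function.Injective f → Function.Injective g → ∀ c : ℕ →₀ 𝕜,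
      ‖Finsupp.linearCombination 𝕜 (W ∘ f) c‖ ≤ D * ‖Finsupp.linearCombination 𝕜 (W ∘ g) c‖ :=
    fun f g hf hg c => le_of_tendsto_of_tendsto' (hWc f c).norm ((hWc g c).norm.const_mul D)
      fun n => hmap (fun _ => hs.truncate 0 n v) (fun k => Nat.pair (f k)) (fun k => Nat.pair (g k))
        (fun k => pair_injective _) (fun k => pair_injective _) (disjointRows_pair _ hf)
        (disjointRows_pair _ hg) c
  exact ⟨W, C, hC, hW, fun π => ⟨dominates_of_bound hp (hWb id π Function.injective_id π.injective),
    dominates_of_bound hp (hWb π id π.injective Function.injective_id)⟩⟩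

/-- Along a subsequence the truncations approach `v` rapidly. Moved into the rows `Nat.pair i`, they
become small perturbations of the copies `W i` of `v`, whose permutations are all equivalent. -/
theorem EquivalentToGenerated.isSymmetricSeq (hp : IsPNorm 𝕜 S p) (hsym : IsSymmetricSeq 𝕜 s)
    (h : EquivalentToGenerated hs B) : IsSymmetricSeq 𝕜 B := by
  obtain ⟨v, y, ⟨hblock, ν, hν, hshift⟩, hy, hBy⟩ := h
  refine ⟨hBy.symm.isBasicSeq hy.1.1, ?_⟩
  choose φ hφ hyφ using hshift
  have hyr : ∀ k, y k = Finsupp.linearCombination 𝕜 s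
      ((hs.truncate 0 (ν k) v).mapDomain (φ k)) := fun k => by
    have h1 := hyφ k
    rw [← hs.linearCombination_truncate_zero, hs.coeff_linearCombination] at h1
    rw [Finsupp.linearCombination_mapDomain]
    exact tendsto_nhds_unique h1 (seriesTendsto_linearCombination _ _)
  have hdis : DisjointRows fun k => (hs.truncate 0 (ν k) v).mapDomain (φ k) := by
    intro k l j hk hl
    rw [Finsupp.mem_support_iff, ← hs.coeff_linearCombination, ← hyr] at hk hl
    rcases lt_trichotomy k l with h | h | h
    · exact absurd (hblock.lt_of_lt h hk hl) (lt_irrefl j)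
    · exact h
    · exact absurd (hblock.lt_of_lt h hl hk) (lt_irrefl j)
  obtain ⟨W, C, hC, hW, hWsym⟩ := hs.exists_copies hp hsym v
  obtain ⟨D, hD, hmap⟩ := hsym.exists_mapDomain_bound hp
  obtain ⟨l, h, hl, hlh⟩ := hy.exists_norm_bounds hp
  obtain ⟨A, hA, hcoef⟩ := hy.1.1.exists_coeff_bound hp hl fun k => (hlh k).1
  have hfreq : ∀ m : ℕ, ∃ᶠ k in atTop,
      ‖hs.proj (ν k) v - v‖ ≤ 1 / (4 * (A * D)) * (1 / 2) ^ m / C := by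
    intro m
    obtain ⟨n₀, hn₀⟩ := eventually_atTop.1
      ((tendsto_iff_norm_sub_tendsto_zero.1 (hs.tendsto_proj v)).eventually_le_const
        (show 0 < 1 / (4 * (A * D)) * (1 / 2 : ℝ) ^ m / C by positivity))
    -- Unboundedness of `ν` gives long truncations infinitely often, not eventually, hence the
    -- passage to `ψ`.
    have hνf : ∃ᶠ k in atTop, n₀ ≤ ν k := fun hev =>
      hν (Filter.IsBoundedUnder.bddAbove_range ⟨n₀, by
        simp only [eventually_map]
        filter_upwards [hev] with k hk
        omega⟩)
    exact hνf.mono fun k hk => hn₀ _ hk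
  obtain ⟨ψ, hψ, hψs⟩ := extraction_forall_of_frequently hfreq
  let Y : ℕ → S := fun i => Finsupp.linearCombination 𝕜 s
    ((hs.truncate 0 (ν (ψ i)) v).mapDomain (Nat.pair i))
  have hdis' : DisjointRows fun i => (hs.truncate 0 (ν (ψ i)) v).mapDomain (φ (ψ i)) :=
    hdis.comp hψ.injective
  have hdisY : DisjointRows fun i => (hs.truncate 0 (ν (ψ i)) v).mapDomain (Nat.pair i) :=
    disjointRows_pair _ Function.injective_id
  have hyψ : (y ∘ ψ) = fun i => Finsupp.linearCombination 𝕜 s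
      ((hs.truncate 0 (ν (ψ i)) v).mapDomain (φ (ψ i))) := funext fun i => hyr (ψ i)
  have hyY : ∀ c : ℕ →₀ 𝕜, ‖Finsupp.linearCombination 𝕜 (y ∘ ψ) c‖ ≤
      D * ‖Finsupp.linearCombination 𝕜 Y c‖ := by
    rw [hyψ]
    exact hmap _ _ _ (fun i => (hφ _).injective) pair_injective hdis' hdisY
  have hYy : ∀ c : ℕ →₀ 𝕜, ‖Finsupp.linearCombination 𝕜 Y c‖ ≤
      D * ‖Finsupp.linearCombination 𝕜 (y ∘ ψ) c‖ := by
    rw [hyψ]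
    exact hmap _ _ _ pair_injective (fun i => (hφ _).injective) hdisY hdis'
  have hYW : SeqEquivalent 𝕜 Y W := by
    refine seqEquivalent_of_perturbation hp (A := A * D) (by positivity) (fun c k => ?_) fun i => ?_
    · have h1 := hcoef (c.mapDomain ψ) (ψ k)
      rw [Finsupp.mapDomain_apply hψ.injective, Finsupp.linearCombination_mapDomain] at h1
      rw [mul_assoc]
      exact h1.trans (mul_le_mul_of_nonneg_left (hyY c) hA.le)
    · have h1 := hψs i
      rw [le_div_iff₀ hC, mul_comm] at h1
      exact (hW i _).trans h1
  have hBW : SeqEquivalent 𝕜 B W :=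
    ((hBy.trans (hy.2 ψ hψ).symm).trans
      ⟨dominates_of_bound hp hYy, dominates_of_bound hp hyY⟩).trans hYW
  exact fun π => ((hBW.comp hp π).trans (hWsym π)).trans hBW.symm

end Symmetric

/-! ### An equivalent `p`-homogeneous norm -/

section AokiRolewicz

variable {𝕜 S : Type*} [RCLike 𝕜] [AddCommGroup S] [Module 𝕜 S]

/-- The Aoki–Rolewicz theorem. -/
theorem IsQuasiNorm.exists_pNorm {q : S → ℝ} (hq : IsQuasiNorm 𝕜 q) :
    ∃ (p : ℝ) (n : S → ℝ), 0 < p ∧ (∀ x y, n (x + y) ≤ n x + n y) ∧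
      (∀ (c : 𝕜) x, n (c • x) = ‖c‖ ^ p * n x) ∧ ∀ x, n x ≤ q x ^ p ∧ q x ^ p ≤ 2 * n x := by
  obtain ⟨κ₀, hκ₀⟩ := hq.add_le
  set κ := max κ₀ 1 with hκdef
  have hκ1 : 1 ≤ κ := le_max_right _ _
  have hκ : ∀ x y, q (x + y) ≤ κ * (q x + q y) := fun x y =>
    (hκ₀ x y).trans (mul_le_mul_of_nonneg_right (le_max_left _ _)
      (add_nonneg (hq.nonneg x) (hq.nonneg y)))
  have h3 : 1 < 3 * κ ^ 2 := by nlinarith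
  have hlog : 0 < Real.log (3 * κ ^ 2) := Real.log_pos h3
  -- Three summands cost a factor at most `3 * κ ^ 2` over their maximum; this `p` turns that factor
  -- into `2`, as the chain metrization lemma requires.
  set p := Real.log 2 / Real.log (3 * κ ^ 2) with hpdef
  have hp : 0 < p := div_pos (Real.log_pos one_lt_two) hlog
  have hp2 : (3 * κ ^ 2) ^ p = 2 := by
    rw [Real.rpow_def_of_pos (by positivity), hpdef, mul_div_cancel₀ _ hlog.ne',
      Real.exp_log two_pos]
  have hneg : ∀ x, q (-x) = q x := fun x => by
    have := hq.smul (-1) x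
    simpa using this
  have h0 : q 0 = 0 := (hq.eq_zero_iff 0).2 rfl
  let d : S → S → NNReal := fun x y => ⟨q (y - x) ^ p, Real.rpow_nonneg (hq.nonneg _) _⟩
  have hdval : ∀ x y, (d x y : ℝ) = q (y - x) ^ p := fun _ _ => rfl
  have hdself : ∀ x, d x x = 0 := fun x => NNReal.eq (by
    rw [hdval, sub_self, h0, Real.zero_rpow hp.ne', NNReal.coe_zero])
  have hdcomm : ∀ x y, d x y = d y x := fun x y => NNReal.eq (by
    rw [hdval, hdval, ← hneg, neg_sub])
  have hd4 : ∀ x₁ x₂ x₃ x₄, d x₁ x₄ ≤ 2 * max (d x₁ x₂) (max (d x₂ x₃) (d x₃ x₄)) := by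
    intro x₁ x₂ x₃ x₄
    set M := max (q (x₂ - x₁)) (max (q (x₃ - x₂)) (q (x₄ - x₃))) with hM
    have hM0 : 0 ≤ M := (hq.nonneg _).trans (le_max_left _ _)
    have h1 : q (x₂ - x₁) ≤ M := le_max_left _ _
    have h2 : q (x₃ - x₂) ≤ M := (le_max_left _ _).trans (le_max_right _ _)
    have h4 : q (x₄ - x₃) ≤ M := (le_max_right _ _).trans (le_max_right _ _)
    have h5 : q (x₄ - x₁) ≤ 3 * κ ^ 2 * M := by
      have e1 : x₄ - x₁ = (x₂ - x₁) + ((x₃ - x₂) + (x₄ - x₃)) := by abel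
      have e2 := hκ (x₂ - x₁) ((x₃ - x₂) + (x₄ - x₃))
      have e3 := hκ (x₃ - x₂) (x₄ - x₃)
      rw [e1]
      calc _ ≤ κ * (q (x₂ - x₁) + q (x₃ - x₂ + (x₄ - x₃))) := e2
        _ ≤ κ * (κ * M + κ * (M + M)) := by
            refine mul_le_mul_of_nonneg_left (add_le_add ?_ (e3.trans
              (mul_le_mul_of_nonneg_left (add_le_add h2 h4) (by positivity)))) (by positivity)
            exact h1.trans (le_mul_of_one_le_left hM0 hκ1)
        _ = 3 * κ ^ 2 * M := by ring
    have h6 : q (x₄ - x₁) ^ p ≤ 2 * M ^ p := by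
      rw [← hp2, ← Real.mul_rpow (by positivity) hM0]
      exact Real.rpow_le_rpow (hq.nonneg _) h5 hp.le
    have h7 : M ^ p ≤ max (q (x₂ - x₁) ^ p) (max (q (x₃ - x₂) ^ p) (q (x₄ - x₃) ^ p)) := by
      rcases max_choice (q (x₂ - x₁)) (max (q (x₃ - x₂)) (q (x₄ - x₃))) with h | h
      · rw [hM, h]; exact le_max_left _ _
      · rw [hM, h]
        rcases max_choice (q (x₃ - x₂)) (q (x₄ - x₃)) with h' | h'
        · rw [h']; exact (le_max_left _ _).trans (le_max_right _ _)
        · rw [h']; exact (le_max_right _ _).trans (le_max_right _ _)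
    rw [← NNReal.coe_le_coe]
    push_cast
    exact h6.trans (mul_le_mul_of_nonneg_left h7 two_pos.le)
  let δ : S → S → ℝ := @dist S (@PseudoMetricSpace.toDist S
    (PseudoMetricSpace.ofPreNNDist d hdself hdcomm))
  have hδtri : ∀ x y z, δ x z ≤ δ x y + δ y z :=
    (PseudoMetricSpace.ofPreNNDist d hdself hdcomm).dist_triangle
  have hδself : ∀ x, δ x x = 0 := (PseudoMetricSpace.ofPreNNDist d hdself hdcomm).dist_self
  have hδle : ∀ x y, δ x y ≤ q (y - x) ^ p :=
    PseudoMetricSpace.dist_ofPreNNDist_le d hdself hdcomm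
  have hleδ : ∀ x y, q (y - x) ^ p ≤ 2 * δ x y :=
    PseudoMetricSpace.le_two_mul_dist_ofPreNNDist d hdself hdcomm hd4
  -- The norm is the infimum of `∑ q z ^ p` over decompositions of `x`: subadditivity and
  -- homogeneity are built in, and the chain metric `δ` supplies the lower bound `q x ^ p / 2`.
  let V : S → Set ℝ := fun x => {r | ∃ L : List S, L.sum = x ∧ (L.map fun z => q z ^ p).sum = r}
  have hVlow : ∀ (L : List S) (y : S), δ y (y + L.sum) ≤ (L.map fun z => q z ^ p).sum := by
    intro L
    induction L with
    | nil => intro y; simp [hδself]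
    | cons z L ih =>
      intro y
      have h1 := hδtri y (y + z) (y + z + L.sum)
      have h2 := hδle y (y + z)
      rw [add_sub_cancel_left] at h2
      simp only [List.sum_cons, List.map_cons]
      rw [← add_assoc]
      linarith [ih (y + z)]
  have hVne : ∀ x, (V x).Nonempty := fun x => ⟨q x ^ p, [x], by simp, by simp⟩
  have hVge : ∀ x, ∀ r ∈ V x, q x ^ p / 2 ≤ r := by
    rintro x r ⟨L, rfl, rfl⟩
    have h1 := hVlow L 0
    have h2 := hleδ 0 (0 + L.sum)
    rw [zero_add, sub_zero] at h2
    rw [zero_add] at h1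
    linarith
  have hVbdd : ∀ x, BddBelow (V x) := fun x => ⟨_, hVge x⟩
  have hsmul_le : ∀ (c : 𝕜) x, sInf (V (c • x)) ≤ ‖c‖ ^ p * sInf (V x) := by
    intro c x
    rw [← smul_eq_mul, ← Real.sInf_smul_of_nonneg (by positivity)]
    refine le_csInf ((hVne x).smul_set) ?_
    rintro _ ⟨_, ⟨L, rfl, rfl⟩, rfl⟩
    refine csInf_le (hVbdd _) ⟨L.map (c • ·), ?_, ?_⟩
    · rw [List.smul_sum]
    · simp only [List.map_map, Function.comp_def, hq.smul, smul_eq_mul]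
      rw [← List.sum_map_mul_left]
      simp only [Real.mul_rpow (norm_nonneg c) (hq.nonneg _)]
  refine ⟨p, fun x => sInf (V x), hp, fun x y => ?_, fun c x => le_antisymm (hsmul_le c x) ?_,
    fun x => ⟨csInf_le (hVbdd x) ⟨[x], by simp, by simp⟩, ?_⟩⟩
  · refine le_of_forall_pos_lt_add fun ε hε => ?_
    obtain ⟨_, ⟨L, rfl, rfl⟩, hL⟩ := exists_lt_of_csInf_lt (hVne x)
      (lt_add_of_pos_right (sInf (V x)) (half_pos hε))
    obtain ⟨_, ⟨L', rfl, rfl⟩, hL'⟩ := exists_lt_of_csInf_lt (hVne y)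
      (lt_add_of_pos_right (sInf (V y)) (half_pos hε))
    have h1 : sInf (V (L.sum + L'.sum)) ≤ ((L ++ L').map fun z => q z ^ p).sum :=
      csInf_le (hVbdd _) ⟨L ++ L', List.sum_append, rfl⟩
    rw [List.map_append, List.sum_append] at h1
    linarith
  · rcases eq_or_ne c 0 with rfl | hc
    · rw [norm_zero, Real.zero_rpow hp.ne', zero_mul]
      exact le_csInf (hVne _) fun r hr =>
        (div_nonneg (Real.rpow_nonneg (hq.nonneg _) _) two_pos.le).trans (hVge _ r hr)
    · have h1 := hsmul_le c⁻¹ (c • x)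
      rw [inv_smul_smul₀ hc, norm_inv, Real.inv_rpow (norm_nonneg c)] at h1
      rwa [← le_inv_mul_iff₀ (Real.rpow_pos_of_pos (norm_pos_iff.2 hc) p)]
  · have := le_csInf (hVne x) (hVge x)
    linarith

end AokiRolewicz

end

/-! ### Transfer from the quasi-norm to the equivalent norm -/

theorem mainTheorem6 {𝕜 S : Type*} [RCLike 𝕜] [AddCommGroup S] [Module 𝕜 S]
    [UniformSpace S] [IsUniformAddGroup S] [ContinuousSMul 𝕜 S]
    (q : S → ℝ) (hq : IsQuasiBanach 𝕜 q)
    (s : ℕ → S) (hs : IsSchauderBasis 𝕜 s) (hsym : IsSymmetricSeq 𝕜 s)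
    (B : ℕ → S) (hB : IsSubsymmetricSeq 𝕜 B) :
    ((∃ (v : S) (y : ℕ → S),
          IsGeneratedByVector hs v y ∧ IsSubsymmetricSeq 𝕜 y ∧ SeqEquivalent 𝕜 B y) ∨
      ((∃ y : ℕ → S, IsBlockBasic hs y ∧ SeqEquivalent 𝕜 B y) ∧
        ∃ z : ℕ → S, IsBlockBasic hs z ∧ IsSemiNormalized q z ∧ IsUniformlyNull hs z ∧
          Dominates 𝕜 B z)) ∧
    ((∃ (v : S) (y : ℕ → S),
          IsGeneratedByVector hs v y ∧ IsSubsymmetricSeq 𝕜 y ∧ SeqEquivalent 𝕜 B y) →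
      IsSymmetricSeq 𝕜 B) := by
  have hqn := hq.quasiNorm
  obtain ⟨p, n, hp, hadd, hsmul, hnq⟩ := hqn.exists_pNorm
  have hq0 := hqn.nonneg
  have hn0 : n 0 = 0 := by simpa [Real.zero_rpow hp.ne'] using hsmul 0 0
  let nrm : AddGroupNorm S :=
    { toFun := n
      map_zero' := hn0
      add_le' := hadd
      neg' := fun x => by simpa using hsmul (-1) x
      eq_zero_of_map_eq_zero' := fun x hx => by
        have h1 := (hnq x).2
        rw [hx, mul_zero] at h1
        have h2 := (Real.rpow_eq_zero (hq0 x) hp.ne').1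
          (le_antisymm h1 (Real.rpow_nonneg (hq0 x) p))
        exact (hqn.eq_zero_iff x).1 h2 }
  let inst : NormedAddCommGroup S := nrm.toNormedAddCommGroup
  have hnorm : ∀ x : S, ‖x‖ = n x := fun _ => rfl
  rename UniformSpace S => U
  -- Group uniformities agree once the neighbourhoods of `0` do, so the given uniform structure may
  -- be replaced by that of the norm.
  have hU : U = inst.toMetricSpace.toUniformSpace := by
    refine IsUniformAddGroup.ext ‹_› inferInstance ?_
    refine hq.nhds_zero.ext Metric.nhds_basis_ball (fun ε hε => ?_) (fun ε hε => ?_)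
    · refine ⟨ε ^ p / 2, by positivity, fun x hx => ?_⟩
      rw [Metric.mem_ball, dist_zero_right, hnorm] at hx
      exact (Real.rpow_lt_rpow_iff (hq0 x) hε.le hp).1 (by linarith [(hnq x).2])
    · refine ⟨ε ^ p⁻¹, by positivity, fun x hx => ?_⟩
      rw [Metric.mem_ball, dist_zero_right, hnorm]
      have h1 := Real.rpow_lt_rpow (hq0 x) hx hp
      rw [Real.rpow_inv_rpow hε.le hp.ne'] at h1
      exact (hnq x).1.trans_lt h1
  subst hU
  have := hq.complete
  have hpn : IsPNorm 𝕜 S p := ⟨hp, hsmul⟩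
  refine ⟨(hs.generated_or_dominates hpn hsym hB).imp_right fun ⟨hy, z, hz, ⟨l, h, hl, hlh⟩, hzn⟩ =>
    -- The bounds for `q` come from `l ≤ n ≤ q ^ p ≤ 2 * n ≤ 2 * h`.
    ⟨hy, z, hz, ⟨l ^ p⁻¹, (2 * h) ^ p⁻¹, by positivity, fun k => ⟨?_, ?_⟩⟩, hzn⟩,
    EquivalentToGenerated.isSymmetricSeq hpn hsym⟩
  · have h1 := Real.rpow_le_rpow hl.le ((hlh k).1.trans (hnq (z k)).1) (inv_pos.2 hp).le
    rwa [Real.rpow_rpow_inv (hq0 _) hp.ne'] at h1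
  · have h1 : q (z k) ^ p ≤ 2 * h := (hnq (z k)).2.trans
      (mul_le_mul_of_nonneg_left (hlh k).2 two_pos.le)
    have h2 := Real.rpow_le_rpow (Real.rpow_nonneg (hq0 _) p) h1 (inv_pos.2 hp).le
    rwa [Real.rpow_rpow_inv (hq0 _) hp.ne'] at h2
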